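/- Let $G=(V,E)$ be a finite simple planar three-connected graph with more than four vertices, and let $\Gamma\subset V$ be the set of vertices of a face of $G$. For $S\subset V$ let $N_G(S)$ be the set of vertices adjacent to a vertex of $S$, let $G[S]$ be the induced subgraph, and let $d_\Gamma$ be the graph distance in $G[\Gamma]$. Put $|u|_G=\langle L_Gu,u\rangle^{1/2}=\big(\sum_{\{p,q\}\in E}(u(p)-u(q))^2\big)^{1/2}$ for $u\in\mathbb R^V$, where $L_G$ is the graph Laplacian, and let $\widetilde L\in\mathbb R^{\Gamma\times\Gamma}$ be the Laplacian of the complete graph on $\Gamma$ with weights $d_\Gamma(p,q)^{-2}$, i.e. $\langle\widetilde L\varphi,\varphi\rangle=\sum_{\{p,q\}\subset\Gamma,\,p\ne q}(\varphi(p)-\varphi(q))^2/d_\Gamma(p,q)^2$. Let $G_{k,\ell}=C_k\,\square\,P_\ell$ be the Cartesian product of the $k$-cycle and the $\ell$-vertex path, with vertices $(i,j)$, $1\le i\le k$, $1\le j\le\ell$, and let $G^*_{k,\ell}$ be obtained from it by adding all edges $\{(i,j),(i\pm1,j+1)\}$, $1\le j\le \ell-1$, with $i\pm1$ taken modulo $k$.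 A graph $H$ on the same vertices with $G_{k,\ell}\subset H\subset G^*_{k,\ell}$ is an $M$-aggregation of $(G,\Gamma)$ if there is a partition of $V$ into sets $a_{i,j}$ ($1\le i\le k$, $1\le j\le\ell$) and a (possibly empty) set $a_*$ such that 1. $G[a_{i,j}]$ is connected and $|a_{i,j}|\le M$ for all $i,j$; 2. $\Gamma\subset\bigcup_{i=1}^k a_{i,1}$, and $\Gamma\cap a_{i,1}\neq\emptyset$ for all $i$; 3. $N_G(a_*)\subset a_*\cup\bigcup_{i=1}^k a_{i,\ell}$; 4. for $(i_1,j_1)\ne(i_2,j_2)$, the pair $\{(i_1,j_1),(i_2,j_2)\}$ is an edge of $H$ if and only if some vertex of $a_{i_1,j_1}$ is adjacent in $G$ to some vertex of $a_{i_2,j_2}$. Let $k,\ell,c,M\in\mathbb N$ with $\ell\ge2$ and $4\ell<k<2c\ell$, and suppose that some $H$ with $G_{k,\ell}\subset H\subset G^*_{k,\ell}$ is an $M$-aggregation of $(G,\Gamma)$. Then for every $\varphi\in\mathbb R^{\Gamma}$ the minimum below is attained and $$\frac{1}{6M\sqrt{M+3}\,\max\{\sqrt{3c},2\pi\}}\,\langle\widetilde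 L\varphi,\varphi\rangle^{1/2}\;\le\;\min_{u|_\Gamma=\varphi}|u|_G\;\le\;28M^2\sqrt{3c+20}\,\langle\widetilde L\varphi,\varphi\rangle^{1/2}.$$ -/

import Mathlib

open scoped Matrix

namespace TraceGraph

section Planarity

variable {V : Type*}

/-- A rotation system (combinatorial embedding) of a simple graph: a permutation of the darts
(oriented edges) whose cycles are exactly the sets of darts leaving a common vertex, i.e. a cyclic
order of the edges around every vertex. -/
structure RotationSystem (G : SimpleGraph V) where
  next : Equiv.Perm G.Dart
  fst_next : ∀ d, (next d).fst = d.fst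
  sameCycle_of_fst_eq : ∀ d d' : G.Dart, d.fst = d'.fst → next.SameCycle d d'

/-- Reversal of darts. -/
def reverseDart (G : SimpleGraph V) : Equiv.Perm G.Dart :=
  SimpleGraph.Dart.symm_involutive.toPerm SimpleGraph.Dart.symm

namespace RotationSystem

variable {G : SimpleGraph V} (R : RotationSystem G)

/-- Face tracing: traverse the dart `u → v`, then continue with the dart that follows `v → u` in the
cyclic order around `v`. The orbits of this permutation are the faces of the embedding. -/
def facePerm : Equiv.Perm G.Dart := R.next * reverseDart G

/-- The faces of the embedding. -/
def Face : Type _ := Quotient (Equiv.Perm.SameCycle.setoid R.facePerm)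

/-- The rotation system is a planar embedding (of a connected graph): the surface obtained by gluing
a disc along every face is the sphere, that is, `|V| - |E| + |F| = 2`. -/
def IsPlanar : Prop :=
  Nat.card V + Nat.card R.Face = Nat.card G.edgeSet + 2

/-- `Γ` is the set of vertices incident with some face of the embedding. -/
def IsFaceVertexSet (Γ : Finset V) : Prop :=
  ∃ d : G.Dart, ∀ v, v ∈ Γ ↔ ∃ d', R.facePerm.SameCycle d d' ∧ d'.fst = v

end RotationSystem

/-- `G` remains connected upon the removal of any at most two vertices. -/
def IsThreeConnected (G : SimpleGraph V) : Prop :=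
  ∀ S : Finset V, S.card ≤ 2 → (G.induce {v | v ∉ S}).Connected

/-- The class of pairs `(G, Γ)` with `G` a planar three-connected graph with more than four vertices
and `Γ` the vertex set of some face of `G`. -/
def IsPlanarWithBoundary (G : SimpleGraph V) (Γ : Finset V) : Prop :=
  4 < Nat.card V ∧ IsThreeConnected G ∧
    ∃ R : RotationSystem G, R.IsPlanar ∧ R.IsFaceVertexSet Γ

end Planarity

section Grids

/-- `G_{k,ℓ} = C_k □ P_ℓ`. -/
def grid (k l : ℕ) : SimpleGraph (Fin k × Fin l) :=
  SimpleGraph.boxProd (SimpleGraph.cycleGraph k) (SimpleGraph.pathGraph l)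

/-- `G*_{k,ℓ}`: the graph `G_{k,ℓ}` with all the diagonal edges `{(i,j), (i ± 1, j + 1)}` added,
the first index being taken modulo `k`. -/
def gridStar (k l : ℕ) : SimpleGraph (Fin k × Fin l) where
  Adj x y := (grid k l).Adj x y ∨
    ((SimpleGraph.cycleGraph k).Adj x.1 y.1 ∧ (SimpleGraph.pathGraph l).Adj x.2 y.2)
  symm := ⟨fun _ _ h => h.imp (fun h => h.symm) (fun h => ⟨h.1.symm, h.2.symm⟩)⟩
  loopless := ⟨fun _ h => h.elim (fun h => h.ne rfl) (fun h => h.1.ne rfl)⟩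

end Grids

section Aggregation

variable {V : Type*}

/-- The sets `a (i, j)` and `aStar` form a partition of the vertices of `G` that exhibits `H` as an
`M`-aggregation of `(G, Γ)`. Indices start from `0`, so the first row is `j = 0` and the last one is
`j + 1 = l`. The set `aStar` may be empty. -/
structure IsAggregationPartition (G : SimpleGraph V) (Γ : Finset V) (M : ℕ) {k l : ℕ}
    (H : SimpleGraph (Fin k × Fin l)) (a : Fin k × Fin l → Finset V) (aStar : Finset V) :
    Prop where
  disjoint : ∀ x y, x ≠ y → Disjoint (a x) (a y)
  disjoint_star : ∀ x, Disjoint (a x) aStar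
  cover : ∀ v, v ∈ aStar ∨ ∃ x, v ∈ a x
  connected : ∀ x, (G.induce {v | v ∈ a x}).Connected
  card_le : ∀ x, (a x).card ≤ M
  boundary_subset : ∀ v ∈ Γ, ∃ (i : Fin k) (j : Fin l), (j : ℕ) = 0 ∧ v ∈ a (i, j)
  boundary_meets : ∀ (i : Fin k) (j : Fin l), (j : ℕ) = 0 → ∃ v ∈ Γ, v ∈ a (i, j)
  star_neighbors : ∀ v ∈ aStar, ∀ w, G.Adj v w →
    w ∈ aStar ∨ ∃ (i : Fin k) (j : Fin l), (j : ℕ) + 1 = l ∧ w ∈ a (i, j)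
  adj_iff : ∀ x y, x ≠ y → (H.Adj x y ↔ ∃ v ∈ a x, ∃ w ∈ a y, G.Adj v w)

/-- `H`, with `G_{k,ℓ} ⊆ H ⊆ G*_{k,ℓ}`, is an `M`-aggregation of `(G, Γ)`. -/
def IsMAggregation (G : SimpleGraph V) (Γ : Finset V) (M : ℕ) {k l : ℕ}
    (H : SimpleGraph (Fin k × Fin l)) : Prop :=
  grid k l ≤ H ∧ H ≤ gridStar k l ∧
    ∃ (a : Fin k × Fin l → Finset V) (aStar : Finset V), IsAggregationPartition G Γ M H a aStar

end Aggregation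

noncomputable section Energies

/-- The energy semi-norm `|u|_G = ⟨L_G u, u⟩^{1/2}`. -/
def energy {V : Type*} [Fintype V] [DecidableEq V] (G : SimpleGraph V) [DecidableRel G.Adj]
    (u : V → ℝ) : ℝ :=
  √((G.lapMatrix ℝ *ᵥ u) ⬝ᵥ u)

/-- The Laplacian of the complete graph on `ι` with edge weights `w`. -/
def weightedLaplacian {ι : Type*} [Fintype ι] [DecidableEq ι] (w : ι → ι → ℝ) : Matrix ι ι ℝ :=
  Matrix.of fun i j => if i = j then ∑ m ∈ Finset.univ.erase i, w i m else -w i j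

/-- `L̃`: the Laplacian of the complete graph on `Γ` with weights `d_Γ(i,j)^{-2}`, where `d_Γ` is the
distance in the induced graph `G[Γ]`. -/
def boundaryLaplacian {V : Type*} [DecidableEq V] (G : SimpleGraph V) (Γ : Finset V) :
    Matrix {v // v ∈ Γ} {v // v ∈ Γ} ℝ :=
  weightedLaplacian fun p q => ((((G.induce {v | v ∈ Γ}).dist p q : ℕ) : ℝ) ^ 2)⁻¹

end Energies

end TraceGraph

/-! The form of `boundaryLaplacian` is a discrete half-order Sobolev seminorm, the natural trace
seminorm for the Dirichlet energy. Both inequalities are proved on the cylinder $C_k\square P_\ell$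
and carried to $G$ through the cells $a_{i,j}$; each transfer costs powers of $M$.

The transfer needs $d_\Gamma$ to be comparable with the cyclic distance between columns. An edge
inside $\Gamma$ changes the column by at most one, which is one direction. The other is topological:
along the face, the vertices of $\Gamma$ in one column are consecutive, and consecutive columns are
joined by an edge of $\Gamma$ (`exists_column`). Otherwise a cell of the first row would alternate
along the face with other cells of that row, although these are still connected to each other
through the second row. `IsPlanar.noncrossing` forbids this. It replaces the Jordan curve theorem by
Euler's formula: counting dimensions, every divergence-free flow is the coboundary of a function on
faces (`IsPlanar.exists_potential`), and such a function separates the two sides of a closed walk.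

Lower bound. To compare two first-row values at distance $d$, go down both columns to a row
depending on $d$ and across that row. Hardy's inequality controls the vertical parts; the rows are
used equally often, which controls the horizontal ones (`cylinder_trace`). On $G$ one representative
per cell gives the cylinder function (`sum_sq_representatives_le`), and boundary values are compared
with representatives (`boundaryForm_le_columns`).

Upper bound. On the cylinder, average over windows whose length grows with the row, and interpolate
linearly to the global mean on the last row (`cylinderExtension`). The result is constant there, so
it extends by that constant to $a_*$. Its pullback is constant on each cell; a correction supported
on $\Gamma$ restores the exact boundary values, cheaply because degrees on $\Gamma$ are bounded
(`exists_extension`). -/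

namespace TraceGraph

/-! ### Rotation systems and face tracing -/

namespace RotationSystem

variable {V : Type*} {G : SimpleGraph V} (R : RotationSystem G)

lemma facePerm_symm (d : G.Dart) : R.facePerm d.symm = R.next d := by
  change R.next d.symm.symm = _
  rw [SimpleGraph.Dart.symm_symm]

lemma fst_facePerm (d : G.Dart) : (R.facePerm d).fst = d.snd :=
  R.fst_next d.symm

lemma eq_of_fst_eq [Finite G.Dart] {α : Type*} (g : G.Dart → α) {v : V}
    (h : ∀ d, d.fst = v → g (R.next d) = g d) {d d' : G.Dart} (hd : d.fst = v)
    (hd' : d'.fst = v) : g d = g d' := by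
  obtain ⟨n, -, -, rfl⟩ := (R.sameCycle_of_fst_eq d d' (hd.trans hd'.symm)).exists_pow_eq''
  have key : ∀ m : ℕ, ((R.next ^ m) d).fst = v ∧ g d = g ((R.next ^ m) d) := by
    intro m
    induction m with
    | zero => exact ⟨hd, rfl⟩
    | succ m ih =>
      rw [pow_succ', Equiv.Perm.mul_apply, R.fst_next, h _ ih.1]
      exact ih
  exact (key n).2

/-- A function on darts that does not change when turning around a vertex of `B`, nor along an edge
inside `B`, is constant on the darts leaving a connected part of `B`. -/
lemma eq_of_reachable [Finite G.Dart] {α : Type*} (g : G.Dart → α) {B : Set V}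
    (hnext : ∀ d : G.Dart, d.fst ∈ B → g (R.next d) = g d)
    (hsymm : ∀ d : G.Dart, d.fst ∈ B → d.snd ∈ B → g d.symm = g d)
    {b b' : B} (hr : (G.induce B).Reachable b b') {d d' : G.Dart} (hd : d.fst = b)
    (hd' : d'.fst = b') : g d = g d' := by
  obtain ⟨p⟩ := hr
  induction p generalizing d with
  | nil =>
    exact R.eq_of_fst_eq g (v := d.fst)
      (fun e he => hnext e (by rw [he, hd]; exact Subtype.coe_prop _)) rfl (hd'.trans hd.symm)
  | @cons x y z h p ih =>
    have hxy : G.Adj x y := h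
    let e : G.Dart := ⟨(x, y), hxy⟩
    have h1 : g d = g e :=
      R.eq_of_fst_eq g (v := (x : V)) (fun e he => hnext e (by rw [he]; exact x.2)) hd rfl
    rw [h1, ← hsymm e x.2 y.2]
    exact ih rfl hd'

lemma eq_of_preconnected [Finite G.Dart] (hG : G.Preconnected) {α : Type*} (g : G.Dart → α)
    (hf : ∀ d, g (R.facePerm d) = g d) (hs : ∀ d : G.Dart, g d.symm = g d) (d d' : G.Dart) :
    g d = g d' := by
  refine R.eq_of_reachable g (B := Set.univ) (b := ⟨d.fst, trivial⟩) (b' := ⟨d'.fst, trivial⟩)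
    (fun e _ => ?_) (fun e _ _ => hs e) ?_ rfl rfl
  · rw [← R.facePerm_symm, hf, hs]
  · exact (SimpleGraph.induceUnivIso G).reachable_iff.1 (hG _ _)

/-! ### Discrete potentials from Euler's formula -/

section Potential

/-- Gradients are orthogonal to coboundaries of functions on faces. -/
lemma sum_grad_mul_coboundary [Fintype V] [DecidableRel G.Adj] (p : V → ℝ)
    (h : G.Dart → ℝ) (hf : ∀ d, h (R.facePerm d) = h d) :
    ∑ d : G.Dart, (p d.snd - p d.fst) * (h d - h d.symm) = 0 := by
  have hsum : ∀ F : G.Dart → ℝ, ∑ d : G.Dart, F d.symm = ∑ d, F d := fun F =>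
    Equiv.sum_comp (reverseDart G) F
  have h1 : ∑ d : G.Dart, p d.fst * h d.symm = ∑ d : G.Dart, p d.fst * h d := by
    rw [← Equiv.sum_comp R.next (fun d => p d.fst * h d)]
    refine Finset.sum_congr rfl fun d _ => ?_
    rw [R.fst_next, ← R.facePerm_symm, hf]
  have h2 : ∑ d : G.Dart, p d.snd * h d = ∑ d : G.Dart, p d.fst * h d.symm := by
    rw [← hsum (fun d => p d.snd * h d)]; rfl
  have h3 : ∑ d : G.Dart, p d.snd * h d.symm = ∑ d : G.Dart, p d.fst * h d := by
    rw [← hsum (fun d => p d.fst * h d)]; rfl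
  calc _ = ∑ d : G.Dart, p d.snd * h d - ∑ d : G.Dart, p d.snd * h d.symm
        - ∑ d : G.Dart, p d.fst * h d + ∑ d : G.Dart, p d.fst * h d.symm := by
        rw [← Finset.sum_sub_distrib, ← Finset.sum_sub_distrib, ← Finset.sum_add_distrib]
        exact Finset.sum_congr rfl fun d _ => by ring
    _ = 0 := by rw [h2, h3, h1]; ring

lemma eq_of_grad_eq_zero (hG : G.Preconnected) (p : V → ℝ)
    (hp : ∀ d : G.Dart, p d.snd - p d.fst = 0) (v w : V) : p v = p w := by
  obtain ⟨q⟩ := hG v w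
  induction q with
  | nil => rfl
  | cons h q ih => rw [← ih]; linarith [hp ⟨(_, _), h⟩]

/-- A divergence-free antisymmetric function on the darts of a planar graph is the coboundary of a
function on faces. -/
theorem IsPlanar.exists_potential [Fintype V] [DecidableEq V] [DecidableRel G.Adj]
    {R : RotationSystem G} (hR : R.IsPlanar) (hG : G.Preconnected)
    [Nonempty G.Dart] (w : G.Dart → ℝ) (hanti : ∀ d : G.Dart, w d.symm = -w d)
    (hdiv : ∀ v, ∑ d : G.Dart with d.fst = v, w d = 0) :
    ∃ h : G.Dart → ℝ, (∀ d, h (R.facePerm d) = h d) ∧ ∀ d : G.Dart, w d = h d - h d.symm := by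
  classical
  let mk : G.Dart → R.Face := fun d => Quotient.mk (Equiv.Perm.SameCycle.setoid R.facePerm) d
  have hmk : ∀ d, mk (R.facePerm d) = mk d := fun d =>
    Quotient.sound (Equiv.Perm.sameCycle_apply_left.2 (Equiv.Perm.SameCycle.refl _ _))
  have : Finite R.Face := Quotient.finite _
  let _ : Fintype R.Face := Fintype.ofFinite _
  have hdart : ∀ e : G.edgeSet, ∃ d : G.Dart, d.edge = e := by
    rintro ⟨e, he⟩
    induction e with
    | _ x y => exact ⟨⟨(x, y), he⟩, rfl⟩
  choose o ho using hdart
  -- Gradient of a vertex function plus coboundary of a face function, read on one chosen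
  -- orientation `o e` of each edge. Surjectivity of `T` is the goal.
  let T : ((V → ℝ) × (R.Face → ℝ)) →ₗ[ℝ] (G.edgeSet → ℝ) :=
    { toFun := fun q e => q.1 (o e).snd - q.1 (o e).fst + (q.2 (mk (o e)) - q.2 (mk (o e).symm))
      map_add' := fun q q' => by ext e; simp; ring
      map_smul' := fun r q => by ext e; simp; ring }
  -- If `T q` represents a divergence-free `w`, the gradient part is orthogonal both to `w` and to
  -- the coboundary part, hence to itself, and vanishes.
  have key : ∀ (w : G.Dart → ℝ), (∀ d : G.Dart, w d.symm = -w d) →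
      (∀ v, ∑ d : G.Dart with d.fst = v, w d = 0) →
      ∀ q : (V → ℝ) × (R.Face → ℝ), (T q = fun e => w (o e)) →
      (∀ d : G.Dart, q.1 d.snd - q.1 d.fst = 0) ∧
        ∀ d : G.Dart, w d = q.2 (mk d) - q.2 (mk d.symm) := by
    intro w hanti hdiv q hq
    have hall : ∀ d : G.Dart,
        w d = q.1 d.snd - q.1 d.fst + (q.2 (mk d) - q.2 (mk d.symm)) := by
      intro d
      have h1 : w (o ⟨d.edge, d.edge_mem⟩) = _ := (congrFun hq ⟨d.edge, d.edge_mem⟩).symm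
      simp only [T, LinearMap.coe_mk, AddHom.coe_mk] at h1
      rcases (SimpleGraph.dart_edge_eq_iff _ _).1 (ho ⟨d.edge, d.edge_mem⟩) with h | h
      · rw [h] at h1; exact h1
      · rw [h, hanti, SimpleGraph.Dart.symm_symm] at h1
        have e1 : d.symm.snd = d.fst := rfl
        have e2 : d.symm.fst = d.snd := rfl
        rw [e1, e2] at h1
        linarith
    have hwp : ∀ p : V → ℝ, ∑ d : G.Dart, p d.fst * w d = 0 := by
      intro p
      rw [← Finset.sum_fiberwise Finset.univ (fun d : G.Dart => d.fst)]
      refine Finset.sum_eq_zero fun v _ => ?_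
      rw [← mul_zero (p v), ← hdiv v, Finset.mul_sum]
      refine Finset.sum_congr rfl fun d hd => ?_
      rw [(Finset.mem_filter.1 hd).2]
    have hwg : ∑ d : G.Dart, (q.1 d.snd - q.1 d.fst) * w d = 0 := by
      have h2 : ∑ d : G.Dart, q.1 d.snd * w d = - ∑ d : G.Dart, q.1 d.fst * w d := by
        rw [← Equiv.sum_comp (reverseDart G) (fun d : G.Dart => q.1 d.snd * w d),
          ← Finset.sum_neg_distrib]
        refine Finset.sum_congr rfl fun d _ => ?_
        change q.1 d.fst * w d.symm = _
        rw [hanti]; ring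
      simp only [sub_mul, Finset.sum_sub_distrib]
      rw [h2, hwp]; simp
    have horth := R.sum_grad_mul_coboundary q.1 (fun d => q.2 (mk d))
      (fun d => congrArg q.2 (hmk d))
    have hsq : ∑ d : G.Dart, (q.1 d.snd - q.1 d.fst) ^ 2 = 0 := by
      rw [← sub_zero (0 : ℝ)]
      nth_rewrite 1 [← hwg]
      rw [← horth, ← Finset.sum_sub_distrib]
      refine Finset.sum_congr rfl fun d _ => ?_
      rw [hall d]; ring
    have hgrad : ∀ d : G.Dart, q.1 d.snd - q.1 d.fst = 0 := fun d => by
      have := (Finset.sum_eq_zero_iff_of_nonneg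
        (fun (d : G.Dart) _ => sq_nonneg (q.1 d.snd - q.1 d.fst))).1 hsq d
        (Finset.mem_univ d)
      exact pow_eq_zero_iff (two_ne_zero) |>.1 this
    refine ⟨hgrad, fun d => ?_⟩
    rw [hall d, hgrad d, zero_add]
  obtain ⟨d₀⟩ := (inferInstance : Nonempty G.Dart)
  -- By `key` with `w = 0`, both components of a kernel element are constant, so two values
  -- determine it and the kernel has dimension at most 2.
  let ev : LinearMap.ker T →ₗ[ℝ] ℝ × ℝ :=
    { toFun := fun q => (q.1.1 d₀.fst, q.1.2 (mk d₀))
      map_add' := fun _ _ => rfl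
      map_smul' := fun _ _ => rfl }
  have hev : Function.Injective ev := by
    rw [← LinearMap.ker_eq_bot, LinearMap.ker_eq_bot']
    rintro ⟨q, hq⟩ h0
    have h01 : q.1 d₀.fst = 0 := congrArg Prod.fst h0
    have h02 : q.2 (mk d₀) = 0 := congrArg Prod.snd h0
    obtain ⟨k1, k2⟩ := key (fun _ => 0) (by simp) (by simp) q (LinearMap.mem_ker.1 hq)
    have e1 : q.1 = 0 := by
      ext v; rw [eq_of_grad_eq_zero hG q.1 k1 v d₀.fst, h01]; rfl
    have e2 : q.2 = 0 := by
      ext f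
      induction f using Quotient.inductionOn with
      | h d =>
        have := R.eq_of_preconnected hG (fun d => q.2 (mk d)) (fun d => congrArg q.2 (hmk d))
          (fun d => by linarith [k2 d]) d d₀
        exact this.trans h02
    exact Subtype.ext (Prod.ext e1 e2)
  have hker : Module.finrank ℝ (LinearMap.ker T) ≤ 2 := by
    have := LinearMap.finrank_le_finrank_of_injective hev
    simpa using this
  have hrn := LinearMap.finrank_range_add_finrank_ker T
  have hsurj : LinearMap.range T = ⊤ := by
    apply Submodule.eq_top_of_finrank_eq
    apply le_antisymm (Submodule.finrank_le _)
    -- Euler's formula: the domain exceeds the codomain by exactly 2, the bound on the kernel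
    -- dimension.
    have hE : Nat.card V + Nat.card R.Face = Nat.card G.edgeSet + 2 := hR
    simp only [Nat.card_eq_fintype_card] at hE
    simp only [Module.finrank_prod, Module.finrank_fintype_fun_eq_card] at hrn ⊢
    omega
  obtain ⟨q, hq⟩ := LinearMap.range_eq_top.1 hsurj (fun e => w (o e))
  exact ⟨fun d => q.2 (mk d), fun d => congrArg q.2 (hmk d), (key w hanti hdiv q hq).2⟩

end Potential

/-! ### A combinatorial Jordan curve argument -/

section Noncrossing

variable [Fintype V] [DecidableEq V] [DecidableRel G.Adj]

lemma sum_fst_single (e : G.Dart) (v : V) :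
    ∑ d : G.Dart with d.fst = v,
      ((if d = e then (1 : ℝ) else 0) - (if d.symm = e then (1 : ℝ) else 0)) =
    (if v = e.fst then 1 else 0) - (if v = e.snd then 1 else 0) := by
  have h : ∀ d : G.Dart, d.symm = e ↔ d = e.symm := fun d =>
    SimpleGraph.Dart.symm_involutive.eq_iff
  simp only [h, Finset.sum_sub_distrib, Finset.sum_ite_eq', Finset.mem_filter, Finset.mem_univ,
    true_and, eq_comm (a := v)]
  rfl

/-- A unit flow between two vertices of a connected set, inside this set. -/
lemma exists_flow {A : Set V} {a b : A} (h : (G.induce A).Reachable a b) :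
    ∃ w : G.Dart → ℝ, (∀ d : G.Dart, w d.symm = -w d) ∧ (∀ d : G.Dart, d.fst ∉ A → w d = 0) ∧
      ∀ v, ∑ d : G.Dart with d.fst = v, w d =
        (if v = a then 1 else 0) - (if v = b then 1 else 0) := by
  obtain ⟨p⟩ := h
  induction p with
  | nil => exact ⟨fun _ => 0, by simp, by simp, by simp⟩
  | @cons x y z hxy p ih =>
    obtain ⟨w, h1, h2, h3⟩ := ih
    have hadj : G.Adj x y := hxy
    let e : G.Dart := ⟨(x, y), hadj⟩
    refine ⟨fun d => ((if d = e then (1 : ℝ) else 0) - (if d.symm = e then (1 : ℝ) else 0)) + w d,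
      fun d => ?_, fun d hd => ?_, fun v => ?_⟩
    · simp only [SimpleGraph.Dart.symm_symm, h1]; ring
    · have e1 : d ≠ e := fun h => hd (h ▸ x.2)
      have e2 : d.symm ≠ e := fun h => hd (by
        have : d = e.symm := by rw [← h, SimpleGraph.Dart.symm_symm]
        rw [this]; exact y.2)
      simp [e1, e2, h2 d hd]
    · rw [Finset.sum_add_distrib, sum_fst_single, h3]
      simp only [e]; ring

/-- In a planar embedding, two disjoint connected sets cannot have interlaced vertices along a
face. -/
theorem IsPlanar.noncrossing {R : RotationSystem G} (hR : R.IsPlanar) (hG : G.Preconnected)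
    (d : G.Dart) {r s t : ℕ} (hr : r < s) (hs : s ≤ t)
    (ht : t < Function.minimalPeriod R.facePerm d) {A B : Set V} (hAB : Disjoint A B)
    {a a' : A} {b b' : B} (ha : d.fst = a) (ha' : (R.facePerm^[s] d).fst = a')
    (hb : (R.facePerm^[r] d).fst = b) (hb' : (R.facePerm^[t] d).fst = b')
    (hA : (G.induce A).Reachable a a') (hB : (G.induce B).Reachable b b') : False := by
  have : Nonempty G.Dart := ⟨d⟩
  obtain ⟨w, h1, h2, h3⟩ := exists_flow hA.symm
  set f := R.facePerm with hf
  -- The indicator of the face boundary from `a` to `a'`. Its antisymmetrization, closed up by the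
  -- flow `w` from `a'` to `a` inside `A`, is divergence-free.
  let ind : G.Dart → ℝ := fun x => ∑ i ∈ Finset.range s, if x = f^[i] d then 1 else 0
  obtain ⟨h, hh, hw⟩ := hR.exists_potential hG (fun x => ind x - ind x.symm + w x)
    (fun x => by simp only [h1, SimpleGraph.Dart.symm_symm]; ring) (fun v => by
      rw [Finset.sum_add_distrib, h3]
      have : ∑ x : G.Dart with x.fst = v, (ind x - ind x.symm) =
          (if v = a then 1 else 0) - (if v = a' then 1 else 0) := by
        simp only [ind, ← Finset.sum_sub_distrib]
        rw [Finset.sum_comm]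
        simp only [sum_fst_single]
        have hsnd : ∀ i, (f^[i] d).snd = (f^[i + 1] d).fst := fun i => by
          rw [Function.iterate_succ_apply', hf, R.fst_facePerm]
        simp only [hsnd]
        rw [Finset.sum_range_sub' (fun i => if v = (f^[i] d).fst then (1 : ℝ) else 0), ha',
          Function.iterate_zero_apply, ha]
      rw [this]; ring)
  have hw' : ∀ x : G.Dart, ind x - ind x.symm + w x = h x - h x.symm := hw
  -- The two counts telescope to the ends of the face path, which lie in `A` and so are not at `f
  -- x`.
  have hind : ∀ x : G.Dart, (f x).fst ∈ B → ind (f x) = ind x := by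
    intro x hx
    have e1 : ind x = ∑ i ∈ Finset.range s, if f x = f^[i + 1] d then (1 : ℝ) else 0 := by
      refine Finset.sum_congr rfl fun i _ => ?_
      rw [Function.iterate_succ_apply']
      simp only [f.injective.eq_iff]
    have e2 := Finset.sum_range_sub' (fun i => if f x = f^[i] d then (1 : ℝ) else 0) s
    rw [Finset.sum_sub_distrib, ← e1] at e2
    have e3 : f x ≠ f^[0] d := fun hc => Set.disjoint_left.1 hAB a.2
      (by rw [← ha]; rw [hc] at hx; exact hx)
    have e4 : f x ≠ f^[s] d := fun hc => Set.disjoint_left.1 hAB a'.2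
      (by rw [← ha']; rw [hc] at hx; exact hx)
    rw [if_neg e3, if_neg e4, sub_zero, sub_eq_zero] at e2
    exact e2
  have hwB : ∀ x : G.Dart, x.fst ∈ B → w x = 0 := fun x hx =>
    h2 x (Set.disjoint_right.1 hAB hx)
  -- Away from `A` the flow is the coboundary of `ind` alone, so `h - ind` cannot change within `B`.
  -- Yet `h` is constant on the face while `ind` is 1 at time `r` and 0 at time `t`.
  have hg := R.eq_of_reachable (fun x => h x - ind x) (B := B)
    (fun x hx => by
      have e1 := hw' x
      have e2 := hwB x hx
      have e3 : h (R.next x) = h x.symm := by rw [← R.facePerm_symm, ← hf, hh]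
      have e4 : ind (R.next x) = ind x.symm := by
        rw [← R.facePerm_symm, ← hf]
        exact hind _ (by rw [hf, R.facePerm_symm, R.fst_next]; exact hx)
      simp only [e3, e4]; linarith)
    (fun x hx _ => by
      have e1 := hw' x
      have e2 := hwB x hx
      linarith) hB hb hb'
  have hconst : ∀ i, h (f^[i] d) = h d := by
    intro i
    induction i with
    | zero => rfl
    | succ i ih => rw [Function.iterate_succ_apply', hh, ih]
  have hinj := Function.iterate_injOn_Iio_minimalPeriod (f := f) (x := d)
  have i1 : ind (f^[r] d) = 1 := by
    have : ∀ i ∈ Finset.range s, (if f^[r] d = f^[i] d then (1 : ℝ) else 0) =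
        if r = i then 1 else 0 := fun i hi => by
      have hi := Finset.mem_range.1 hi
      have : f^[r] d = f^[i] d ↔ r = i :=
        hinj.eq_iff (Set.mem_Iio.2 (by omega)) (Set.mem_Iio.2 (by omega))
      simp only [this]
    change ∑ i ∈ Finset.range s, _ = _
    rw [Finset.sum_congr rfl this, Finset.sum_ite_eq, if_pos (Finset.mem_range.2 hr)]
  have i2 : ind (f^[t] d) = 0 := by
    refine Finset.sum_eq_zero fun i hi => if_neg fun hc => ?_
    have hi := Finset.mem_range.1 hi
    have := hinj (Set.mem_Iio.2 ht) (Set.mem_Iio.2 (by omega)) hc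
    omega
  simp only [hconst, i1, i2] at hg
  linarith

end Noncrossing

end RotationSystem

/-! ### Reachability inside a set, cyclic indices and walks along a face -/

section ReachableIn

variable {V : Type*} {G : SimpleGraph V} {S T : Set V} {u v w : V}

/-- `v` and `w` can be joined by a walk of `G` inside `S`. -/
def ReachableIn (G : SimpleGraph V) (S : Set V) (v w : V) : Prop :=
  ∃ (hv : v ∈ S) (hw : w ∈ S), (G.induce S).Reachable ⟨v, hv⟩ ⟨w, hw⟩

namespace ReachableIn

lemma refl (hv : v ∈ S) : ReachableIn G S v v := ⟨hv, hv, SimpleGraph.Reachable.refl _⟩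

lemma symm (h : ReachableIn G S v w) : ReachableIn G S w v :=
  let ⟨hv, hw, h⟩ := h; ⟨hw, hv, h.symm⟩

lemma trans (h : ReachableIn G S u v) (h' : ReachableIn G S v w) : ReachableIn G S u w :=
  let ⟨hu, _, h⟩ := h
  let ⟨_, hw, h'⟩ := h'
  ⟨hu, hw, h.trans h'⟩

lemma of_adj (h : G.Adj v w) (hv : v ∈ S) (hw : w ∈ S) : ReachableIn G S v w :=
  ⟨hv, hw, SimpleGraph.Adj.reachable (G := G.induce S) (u := ⟨v, hv⟩) (v := ⟨w, hw⟩) h⟩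

lemma mono (hST : S ⊆ T) (h : ReachableIn G S v w) : ReachableIn G T v w :=
  let ⟨hv, hw, h⟩ := h
  ⟨hST hv, hST hw, h.map (G.induceHomOfLE hST).toHom⟩

lemma of_connected (h : (G.induce S).Connected) (hv : v ∈ S) (hw : w ∈ S) : ReachableIn G S v w :=
  ⟨hv, hw, h.preconnected _ _⟩

lemma dist_lt_card {S : Finset V} {Γ : Finset V} (hS : S ⊆ Γ) (h : ReachableIn G {v | v ∈ S} v w)
    (hv : v ∈ Γ) (hw : w ∈ Γ) :
    (G.induce {v | v ∈ Γ}).dist ⟨v, hv⟩ ⟨w, hw⟩ < S.card := by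
  obtain ⟨h1, h2, h⟩ := h
  obtain ⟨p, hp⟩ := h.exists_isPath
  have hlen := hp.length_lt
  have hsub : {v | v ∈ S} ⊆ {v | v ∈ Γ} := fun _ hx => hS hx
  have := SimpleGraph.dist_le (p.map (G.induceHomOfLE hsub).toHom)
  rw [SimpleGraph.Walk.length_map] at this
  refine lt_of_le_of_lt this ?_
  simpa using hlen

end ReachableIn

end ReachableIn

lemma exists_step_of_exit {P : ℕ → Prop} {s t : ℕ} (hst : s ≤ t) (hs : P s) (ht : ¬P t) :
    ∃ r, s ≤ r ∧ r < t ∧ P r ∧ ¬P (r + 1) := by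
  induction t, hst using Nat.le_induction with
  | base => exact absurd hs ht
  | succ t hst ih =>
    by_cases h : P t
    · exact ⟨t, hst, t.lt_succ_self, h, ht⟩
    · obtain ⟨r, h1, h2, h3⟩ := ih h
      exact ⟨r, h1, h2.trans t.lt_succ_self, h3⟩

section Fin

variable {n : ℕ}

lemma val_nsmul_one (t : ℕ) : (t • (1 : Fin (n + 2))).val = t % (n + 2) := by
  induction t with
  | zero => simp
  | succ t ih => rw [succ_nsmul, Fin.val_add, ih, Fin.val_one, Nat.mod_add_mod]

lemma val_nsmul_one_self (x : Fin (n + 2)) : x.val • (1 : Fin (n + 2)) = x :=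
  Fin.ext (by rw [val_nsmul_one, Nat.mod_eq_of_lt x.2])

end Fin

section Face

variable {V : Type*} {G : SimpleGraph V} {R : RotationSystem G}

lemma exists_iterate_eq_of_sameCycle {α : Type*} [Finite α] {f : Equiv.Perm α} {x y : α}
    (h : f.SameCycle x y) : ∃ t < Function.minimalPeriod f x, f^[t] x = y := by
  obtain ⟨t, -, -, rfl⟩ := h.exists_pow_eq''
  have hpos : 0 < Function.minimalPeriod f x :=
    Function.minimalPeriod_pos_of_mem_periodicPts (f.injective.mem_periodicPts x)
  exact ⟨t % Function.minimalPeriod f x, Nat.mod_lt _ hpos, by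
    rw [Function.iterate_mod_minimalPeriod_eq, Equiv.Perm.iterate_eq_pow]⟩

lemma RotationSystem.adj_iterate_facePerm (R : RotationSystem G) (d : G.Dart) (t : ℕ) :
    G.Adj (R.facePerm^[t] d).fst (R.facePerm^[t + 1] d).fst := by
  rw [Function.iterate_succ_apply', R.fst_facePerm]
  exact (R.facePerm^[t] d).adj

lemma RotationSystem.reachableIn_iterate (R : RotationSystem G) (d : G.Dart) {S : Set V} {s t : ℕ}
    (hst : s ≤ t) (h : ∀ r, s ≤ r → r ≤ t → (R.facePerm^[r] d).fst ∈ S) :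
    ReachableIn G S (R.facePerm^[s] d).fst (R.facePerm^[t] d).fst := by
  induction t, hst using Nat.le_induction with
  | base => exact .refl (h s le_rfl le_rfl)
  | succ t hst ih =>
    exact (ih fun r h1 h2 => h r h1 (h2.trans t.le_succ)).trans
      (.of_adj (R.adj_iterate_facePerm d t) (h t hst t.le_succ) (h _ (hst.trans t.le_succ) le_rfl))

lemma sameCycle_iterate {α : Type*} (f : Equiv.Perm α) (x : α) (t : ℕ) :
    f.SameCycle x (f^[t] x) := by
  rw [Equiv.Perm.iterate_eq_pow]
  exact ⟨t, by simp⟩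

end Face

/-! ### Columns along the boundary face -/

namespace IsAggregationPartition

variable {V : Type*} {G : SimpleGraph V} {Γ : Finset V} {M n m : ℕ}
  {H : SimpleGraph (Fin (n + 2) × Fin (m + 2))} {a : Fin (n + 2) × Fin (m + 2) → Finset V}
  {aStar : Finset V}

lemma eq_of_mem (hP : IsAggregationPartition G Γ M H a aStar) {x y v} (hx : v ∈ a x)
    (hy : v ∈ a y) : x = y := by
  by_contra h
  exact Finset.disjoint_left.1 (hP.disjoint x y h) hx hy

lemma reachableIn_biUnion (hP : IsAggregationPartition G Γ M H a aStar)
    {X : Set (Fin (n + 2) × Fin (m + 2))} {x y : Fin (n + 2) × Fin (m + 2)}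
    (h : ReachableIn H X x y) {v w : V} (hv : v ∈ a x) (hw : w ∈ a y) :
    ReachableIn G {v | ∃ x ∈ X, v ∈ a x} v w := by
  have hint : ∀ z ∈ X, ∀ v ∈ a z, ∀ w ∈ a z, ReachableIn G {v | ∃ x ∈ X, v ∈ a x} v w :=
    fun z hz v hv w hw =>
      (ReachableIn.of_connected (hP.connected z) hv hw).mono fun v hv => ⟨z, hz, hv⟩
  obtain ⟨hx, hy, ⟨p⟩⟩ := h
  generalize hxx : (⟨x, hx⟩ : X) = x' at p
  generalize hyy : (⟨y, hy⟩ : X) = y' at p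
  induction p generalizing x v with
  | nil =>
    have : x = y := congrArg Subtype.val (hxx.trans hyy.symm)
    subst this
    exact hint x hx v hv w hw
  | @cons x' z' y' h p ih =>
    have hadj : H.Adj x' z' := h
    obtain ⟨v', hv', w', hw', hvw⟩ := (hP.adj_iff _ _ hadj.ne).1 hadj
    subst hxx
    exact ((hint x hx v hv v' hv').trans (.of_adj hvw ⟨x, hx, hv'⟩ ⟨_, z'.2, hw'⟩)).trans
      (ih hw' z'.2 rfl hyy)

/-- After removal of one vertex of the first row, the rest of the first row is still joined through
the second row. -/
lemma reachableIn_ne (hgrid : grid (n + 2) (m + 2) ≤ H) {i i₁ i₂ : Fin (n + 2)} (h₁ : i₁ ≠ i)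
    (h₂ : i₂ ≠ i) : ReachableIn H {x | x ≠ (i, 0)} (i₁, 0) (i₂, 0) := by
  have hdown : ∀ i' : Fin (n + 2), i' ≠ i → ReachableIn H {x | x ≠ (i, 0)} (i', 0) (i', 1) := by
    intro i' hi'
    refine .of_adj (hgrid ?_) (by simp [hi']) (by simp)
    simp [grid, SimpleGraph.boxProd_adj, SimpleGraph.pathGraph_adj]
  have hrow : ∀ t : ℕ, ReachableIn H {x | x ≠ (i, 0)} (i₁, 1) (i₁ + t • 1, 1) := by
    intro t
    induction t with
    | zero => simpa using ReachableIn.refl (by simp)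
    | succ t ih =>
      refine ih.trans (.of_adj (hgrid ?_) (by simp) (by simp))
      simp [grid, SimpleGraph.boxProd_adj, SimpleGraph.cycleGraph_adj, succ_nsmul]
  have := hrow (i₂ - i₁).val
  rw [show i₁ + (i₂ - i₁).val • (1 : Fin (n + 2)) = i₂ by rw [val_nsmul_one_self]; abel] at this
  exact ((hdown i₁ h₁).trans this).trans (hdown i₂ h₂).symm

/-- The column index changes by at most one along an edge between boundary vertices. -/
lemma column_adj (hP : IsAggregationPartition G Γ M H a aStar)
    (hstar : H ≤ gridStar (n + 2) (m + 2)) {i j : Fin (n + 2)} {v w : V} (hv : v ∈ a (i, 0))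
    (hw : w ∈ a (j, 0)) (h : G.Adj v w) : j = i ∨ j = i + 1 ∨ i = j + 1 := by
  by_cases hij : i = j
  · exact Or.inl hij.symm
  have hadj := hstar ((hP.adj_iff (i, 0) (j, 0) (by simpa using hij)).2 ⟨v, hv, w, hw, h⟩)
  simp only [gridStar, grid, SimpleGraph.boxProd_adj, SimpleGraph.cycleGraph_adj,
    SimpleGraph.pathGraph_adj] at hadj
  simp only [sub_eq_iff_eq_add, Fin.val_zero] at hadj
  have : i = 1 + j ∨ j = 1 + i := by simpa using hadj
  rw [add_comm 1 j, add_comm 1 i] at this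
  tauto

variable [Fintype V] [DecidableEq V] [DecidableRel G.Adj] {R : RotationSystem G}
  {C : V → Fin (n + 2)}

/-- The boundary vertices in one column are consecutive along the face. -/
lemma column_arc (hP : IsAggregationPartition G Γ M H a aStar) (hgrid : grid (n + 2) (m + 2) ≤ H)
    (hR : R.IsPlanar) (hG : G.Preconnected) {d : G.Dart}
    (hC : ∀ t, (R.facePerm^[t] d).fst ∈ a (C (R.facePerm^[t] d).fst, 0)) {s : ℕ}
    (hs : s < Function.minimalPeriod R.facePerm d)
    (hcol : C (R.facePerm^[s] d).fst = C d.fst) :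
    (∀ r ≤ s, C (R.facePerm^[r] d).fst = C d.fst) ∨
      ∀ r, s ≤ r → r ≤ Function.minimalPeriod R.facePerm d →
        C (R.facePerm^[r] d).fst = C d.fst := by
  by_contra! hcon
  obtain ⟨⟨r, hrs, hr⟩, t, hst, htn, ht⟩ := hcon
  have hrs' : r < s := lt_of_le_of_ne hrs (by rintro rfl; exact hr hcol)
  have htn' : t < Function.minimalPeriod R.facePerm d := lt_of_le_of_ne htn (by
    rintro rfl
    rw [Function.iterate_minimalPeriod] at ht
    exact ht rfl)
  -- The vertices at times `r` and `t` are joined through the other cells, and those at times `0`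
  -- and `s` inside their common cell: an interlaced pair of disjoint connected sets.
  obtain ⟨hb, hb', hB⟩ := hP.reachableIn_biUnion (reachableIn_ne hgrid hr ht) (hC r) (hC t)
  have ha : d.fst ∈ a (C d.fst, 0) := hC 0
  have ha' : (R.facePerm^[s] d).fst ∈ a (C d.fst, 0) := hcol ▸ hC s
  refine hR.noncrossing hG d hrs' hst htn' (A := {v | v ∈ a (C d.fst, 0)}) ?_
    (a := ⟨_, ha⟩) (a' := ⟨_, ha'⟩) rfl rfl rfl rfl ((hP.connected _).preconnected _ _) hB
  rw [Set.disjoint_left]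
  rintro v hv ⟨x, hx, hvx⟩
  exact hx (hP.eq_of_mem hvx hv)

/-- The columns of the first row cut the face into consecutive paths; hence boundary vertices in
nearby columns are close to each other on the boundary. -/
theorem exists_column (hP : IsAggregationPartition G Γ M H a aStar)
    (hgrid : grid (n + 2) (m + 2) ≤ H) (hstar : H ≤ gridStar (n + 2) (m + 2)) (hn : 1 ≤ n)
    (hR : R.IsPlanar) (hG : G.Preconnected) (hΓ : R.IsFaceVertexSet Γ) :
    (G.induce {v | v ∈ Γ}).Preconnected ∧
    ∃ C : V → Fin (n + 2), (∀ v ∈ Γ, v ∈ a (C v, 0)) ∧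
      ∀ (p q : {v // v ∈ Γ}) (t : ℕ), C q = C p + t • 1 →
        (G.induce {v | v ∈ Γ}).dist p q < M * (t + 1) := by
  classical
  have hex : ∀ v, ∃ i : Fin (n + 2), v ∈ Γ → v ∈ a (i, 0) := fun v => by
    by_cases hv : v ∈ Γ
    · obtain ⟨i, j, hj, h⟩ := hP.boundary_subset v hv
      rw [show j = 0 from Fin.ext hj] at h
      exact ⟨i, fun _ => h⟩
    · exact ⟨0, fun h => absurd h hv⟩
  choose C hC using hex
  have hCeq : ∀ i v, v ∈ Γ → v ∈ a (i, 0) → C v = i := fun i v hv hi =>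
    congrArg Prod.fst (hP.eq_of_mem (hC v hv) hi)
  obtain ⟨d₀, hd₀⟩ := hΓ
  set f := R.facePerm with hf
  have hmemΓ : ∀ d, f.SameCycle d₀ d → ∀ t, (f^[t] d).fst ∈ Γ := fun d hd t =>
    (hd₀ _).2 ⟨_, hd.trans (sameCycle_iterate f d t), rfl⟩
  have hmemC : ∀ d, f.SameCycle d₀ d → ∀ t, (f^[t] d).fst ∈ a (C (f^[t] d).fst, 0) :=
    fun d hd t => hC _ (hmemΓ d hd t)
  have hpair : ∀ p ∈ Γ, ∀ q ∈ Γ, ∃ d, f.SameCycle d₀ d ∧ d.fst = p ∧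
      ∃ t < Function.minimalPeriod f d, (f^[t] d).fst = q := by
    intro p hp q hq
    obtain ⟨d, hd, hdp⟩ := (hd₀ p).1 hp
    obtain ⟨e, he, heq⟩ := (hd₀ q).1 hq
    obtain ⟨t, ht, hte⟩ := exists_iterate_eq_of_sameCycle (hd.symm.trans he)
    exact ⟨d, hd, hdp, t, ht, by rw [hte, heq]⟩
  have hsame : ∀ p ∈ Γ, ∀ q ∈ Γ, C q = C p → ReachableIn G {v | v ∈ Γ ∧ C v = C p} p q := by
    intro p hp q hq hpq
    obtain ⟨d, hd, rfl, t, ht, rfl⟩ := hpair p hp q hq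
    rcases hP.column_arc hgrid hR hG (hmemC d hd) ht hpq with h | h
    · exact R.reachableIn_iterate d (s := 0) (Nat.zero_le t)
        fun r _ hr => ⟨hmemΓ d hd r, h r hr⟩
    · have := R.reachableIn_iterate d ht.le (S := {v | v ∈ Γ ∧ C v = C d.fst})
        fun r h1 h2 => ⟨hmemΓ d hd r, h r h1 h2⟩
      rw [← hf, Function.iterate_minimalPeriod] at this
      exact this.symm
  -- Here at least three columns are needed: `i` and `i + 2` must differ.
  have hne : ∀ i : Fin (n + 2), i ≠ i + 1 ∧ i ≠ i + 1 + 1 := by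
    intro i
    constructor
    · simp
    · rw [add_assoc, ne_eq, left_eq_add, Fin.ext_iff, Fin.val_add]
      rw [Fin.val_one, Nat.mod_eq_of_lt (by omega)]
      simp
  have hstep : ∀ i : Fin (n + 2), ∃ p ∈ Γ, ∃ q ∈ Γ, G.Adj p q ∧ C p = i ∧ C q = i + 1 := by
    intro i
    obtain ⟨p, hp, hpi⟩ := hP.boundary_meets (i + 1) 0 rfl
    obtain ⟨q, hq, hqi⟩ := hP.boundary_meets i 0 rfl
    have hp' := hCeq _ p hp hpi
    have hq' := hCeq _ q hq hqi
    obtain ⟨d, hd, rfl, t, ht, rfl⟩ := hpair p hp q hq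
    by_contra! hcon
    have hexit : ∀ p ∈ Γ, ∀ q ∈ Γ, G.Adj p q → C p = i + 1 → C q ≠ i + 1 → C q = i + 1 + 1 := by
      intro p hp q hq hadj h1 h2
      rcases hP.column_adj hstar (hC p hp) (hC q hq) hadj with h | h | h
      · exact absurd (h.trans h1) h2
      · rw [h, h1]
      · exact absurd h1 (hcon q hq p hp hadj.symm (by rw [h1] at h; exact add_right_cancel h.symm))
    -- Starting in column `i + 1` and passing column `i` at time `t`, the face leaves column `i + 1`
    -- before `t` and returns to it after `t`. Without edges between columns `i` and `i + 1`, both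
    -- crossings are to column `i + 2`.
    obtain ⟨r, -, hrt, hr1, hr2⟩ := exists_step_of_exit
      (P := fun r => C (f^[r] d).fst = i + 1) (Nat.zero_le t) hp' (by
        rw [hq']; exact (hne i).1)
    obtain ⟨s, hts, hsn, hs1, hs2⟩ := exists_step_of_exit
      (P := fun r => C (f^[r] d).fst ≠ i + 1) ht.le (by rw [hq']; exact (hne i).1) (by
        rw [Function.iterate_minimalPeriod]; exact not_not.2 hp')
    have er := hexit _ (hmemΓ d hd r) _ (hmemΓ d hd (r + 1)) (R.adj_iterate_facePerm d r) hr1 hr2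
    have es := hexit _ (hmemΓ d hd (s + 1)) _ (hmemΓ d hd s) (R.adj_iterate_facePerm d s).symm
      (not_not.1 hs2) hs1
    have hcyc := hd.trans (sameCycle_iterate f d (r + 1))
    have hper : Function.minimalPeriod f (f^[r + 1] d) = Function.minimalPeriod f d :=
      Function.minimalPeriod_apply_iterate (f.injective.mem_periodicPts d) _
    have hadd : ∀ j, f^[j] (f^[r + 1] d) = f^[j + (r + 1)] d := fun j =>
      (Function.iterate_add_apply f j (r + 1) d).symm
    have hrs : r + 1 ≤ s := by omega
    -- One of the two arcs between these visits to column `i + 2` must stay in that column; but one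
    -- contains time `t`, in column `i`, and the other the full period, in column `i + 1`.
    rcases hP.column_arc hgrid hR hG (hmemC _ hcyc) (s := s - (r + 1))
      (by rw [← hf, hper]; omega) (by rw [← hf, hadd, Nat.sub_add_cancel hrs, es, er]) with h | h
    · have := h (t - (r + 1)) (by omega)
      rw [← hf, hadd, Nat.sub_add_cancel (by omega), hq', er] at this
      exact (hne i).2 this
    · have := h (Function.minimalPeriod f d - (r + 1)) (by omega) (by rw [← hf, hper]; omega)
      rw [← hf, hadd, Nat.sub_add_cancel (by omega), Function.iterate_minimalPeriod, hp',
        er] at this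
      exact (hne (i + 1)).1 this
  have hreach : ∀ t : ℕ, ∀ p ∈ Γ, ∀ q ∈ Γ, C q = C p + t • 1 →
      ReachableIn G {v | v ∈ Γ ∧ ∃ e ≤ t, C v = C p + e • 1} p q := by
    intro t p hp
    induction t with
    | zero =>
      intro q hq h
      refine (hsame p hp q hq (by simpa using h)).mono fun v hv => ⟨hv.1, 0, le_rfl, by simp [hv.2]⟩
    | succ t ih =>
      intro q hq h
      obtain ⟨p', hp', q', hq', hadj, h1, h2⟩ := hstep (C p + t • 1)
      have h3 : C q' = C p + (t + 1) • 1 := by rw [h2, succ_nsmul, add_assoc]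
      have r1 : ReachableIn G {v | v ∈ Γ ∧ ∃ e ≤ t + 1, C v = C p + e • 1} p p' := by
        refine (ih p' hp' h1).mono ?_
        rintro v ⟨hv, e, he, hve⟩
        exact ⟨hv, e, he.trans t.le_succ, hve⟩
      have r2 : ReachableIn G {v | v ∈ Γ ∧ ∃ e ≤ t + 1, C v = C p + e • 1} q' q :=
        (hsame q' hq' q hq (h.trans h3.symm)).mono
          fun v hv => ⟨hv.1, t + 1, le_rfl, hv.2.trans h3⟩
      exact (r1.trans (.of_adj hadj ⟨hp', t, t.le_succ, h1⟩ ⟨hq', t + 1, le_rfl, h3⟩)).trans r2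
  refine ⟨fun p q => ?_, C, hC, fun p q t h => ?_⟩
  · obtain ⟨d, hd, hdp, t, -, hdq⟩ := hpair p p.2 q q.2
    obtain ⟨_, _, h⟩ := R.reachableIn_iterate d (S := {v | v ∈ Γ}) (Nat.zero_le t)
      fun r _ _ => hmemΓ d hd r
    convert h
    · exact hdp.symm
    · exact hdq.symm
  · let S := Γ.filter fun v => ∃ e ≤ t, C v = C p + e • 1
    have hr : ReachableIn G {v | v ∈ S} p q := by
      have := hreach t p p.2 q q.2 h
      simpa only [S, Finset.mem_filter] using this
    refine lt_of_lt_of_le (hr.dist_lt_card (Finset.filter_subset _ _) p.2 q.2) ?_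
    have hsub : S ⊆ (Finset.range (t + 1)).biUnion fun e => a (C p + e • 1, 0) := by
      intro v hv
      obtain ⟨hvΓ, e, he, hve⟩ := Finset.mem_filter.1 hv
      exact Finset.mem_biUnion.2 ⟨e, Finset.mem_range.2 (by omega), hve ▸ hC v hvΓ⟩
    calc S.card ≤ _ := Finset.card_le_card hsub
      _ ≤ (Finset.range (t + 1)).card * M := Finset.card_biUnion_le_card_mul _ _ _
        fun e _ => hP.card_le _
      _ = M * (t + 1) := by rw [Finset.card_range, mul_comm]

end IsAggregationPartition

/-! ### Trace and extension inequalities on a discrete cylinder -/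

section Cylinder

/-- Hardy's inequality for finite sums. -/
lemma hardy_inequality (x : ℕ → ℝ) (N : ℕ) :
    ∑ d ∈ Finset.range N, ((∑ s ∈ Finset.range (d + 1), x s) / (d + 1)) ^ 2 ≤
      4 * ∑ d ∈ Finset.range N, x d ^ 2 := by
  -- The extra multiple of the squared last mean makes the induction close; with `y` the new mean
  -- and `z` the old one, the slack is made of the squares `(z - y) ^ 2` and `(2 * x n - y) ^ 2`.
  suffices h : ∑ d ∈ Finset.range N, ((∑ s ∈ Finset.range (d + 1), x s) / (d + 1)) ^ 2 +
      2 * N * ((∑ s ∈ Finset.range N, x s) / N) ^ 2 ≤ 4 * ∑ d ∈ Finset.range N, x d ^ 2 by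
    have : (0 : ℝ) ≤ 2 * N * ((∑ s ∈ Finset.range N, x s) / N) ^ 2 := by positivity
    linarith
  induction N with
  | zero => simp
  | succ n ih =>
    rw [Finset.sum_range_succ, Finset.sum_range_succ (fun d => x d ^ 2)]
    push_cast
    set y := (∑ s ∈ Finset.range (n + 1), x s) / ((n : ℝ) + 1) with hy
    set z := (∑ s ∈ Finset.range n, x s) / (n : ℝ) with hz
    have hz' : (n : ℝ) * z = ∑ s ∈ Finset.range n, x s := by
      rcases Nat.eq_zero_or_pos n with rfl | hn
      · simp
      · rw [hz]; field_simp
    have hy' : ((n : ℝ) + 1) * y = n * z + x n := by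
      rw [hz', ← Finset.sum_range_succ, hy]; field_simp
    have hx : x n = (n + 1) * y - n * z := by linarith
    have h1 : (0 : ℝ) ≤ n * (z - y) ^ 2 := by positivity
    have h2 : 0 ≤ (2 * x n - y) ^ 2 := sq_nonneg _
    have h3 : 4 * x n * y = 4 * ((n + 1) * y - n * z) * y := by rw [hx]
    nlinarith

variable {A : Type*} [AddCommGroup A]

lemma sum_shift [Fintype A] (g : A → ℝ) (e : A) : ∑ i, g (i + e) = ∑ i, g i :=
  Equiv.sum_comp (Equiv.addRight e) g

/-- Telescoping and Cauchy–Schwarz give one factor `t`; translation invariance of the sum over the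
cycle gives the other. -/
lemma sum_sq_shift_le [Fintype A] (g : A → ℝ) (e : A) (t : ℕ) :
    ∑ i, (g (i + t • e) - g i) ^ 2 ≤ (t : ℝ) ^ 2 * ∑ i, (g (i + e) - g i) ^ 2 := by
  have h1 : ∀ i, (g (i + t • e) - g i) ^ 2 ≤
      t * ∑ s ∈ Finset.range t, (g (i + s • e + e) - g (i + s • e)) ^ 2 := by
    intro i
    have h := Finset.sum_range_sub (fun s => g (i + s • e)) t
    simp only [zero_smul, add_zero, succ_nsmul, ← add_assoc] at h
    rw [← h]
    simpa using sq_sum_le_card_mul_sum_sq (s := Finset.range t)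
      (f := fun s => g (i + s • e + e) - g (i + s • e))
  calc _ ≤ ∑ i, t * ∑ s ∈ Finset.range t, (g (i + s • e + e) - g (i + s • e)) ^ 2 :=
        Finset.sum_le_sum fun i _ => h1 i
    _ = t * ∑ s ∈ Finset.range t, ∑ i, (g (i + s • e + e) - g (i + s • e)) ^ 2 := by
        rw [← Finset.mul_sum, Finset.sum_comm]
    _ = (t : ℝ) ^ 2 * ∑ i, (g (i + e) - g i) ^ 2 := by
        simp only [sum_shift (fun i => (g (i + e) - g i) ^ 2), Finset.sum_const,
          Finset.card_range, nsmul_eq_mul]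
        ring

lemma sum_range_mul_mod (F : ℕ → ℝ) (c l : ℕ) :
    ∑ d ∈ Finset.range (c * l), F (d % l) = c * ∑ j ∈ Finset.range l, F j := by
  induction c with
  | zero => simp
  | succ c ih =>
    rw [Nat.succ_mul, Finset.sum_range_add, ih]
    have : ∀ x ∈ Finset.range l, F ((c * l + x) % l) = F x := fun x hx => by
      rw [Nat.mul_add_mod_self_right, Nat.mod_eq_of_lt (Finset.mem_range.1 hx)]
    rw [Finset.sum_congr rfl this]
    push_cast; ring

/-- The trace inequality on a discrete cylinder with rows `0, …, L`. -/
theorem cylinder_trace [Fintype A] (U : A → ℕ → ℝ) (e : A) (c L : ℕ) :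
    ∑ d ∈ Finset.range (c * (L + 1)),
        (∑ i, (U (i + (d + 1) • e) 0 - U i 0) ^ 2) / ((d : ℝ) + 1) ^ 2 ≤
      3 * c * ∑ j ∈ Finset.range (L + 1), ∑ i, (U (i + e) j - U i j) ^ 2 +
        24 * ∑ j ∈ Finset.range L, ∑ i, (U i (j + 1) - U i j) ^ 2 := by
  -- Cutting off at `L` lets Hardy's inequality run over any length while the right-hand side
  -- remains the vertical energy of the column.
  let b : A → ℕ → ℝ := fun i s => if s < L then |U i (s + 1) - U i s| else 0
  have hb : ∀ i s, 0 ≤ b i s := fun i s => by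
    simp only [b]; split_ifs <;> positivity
  have hvert : ∀ i d, |U i (d % (L + 1)) - U i 0| ≤ ∑ s ∈ Finset.range (d + 1), b i s := by
    intro i d
    have hlt : d % (L + 1) < L + 1 := Nat.mod_lt d (Nat.succ_pos L)
    have hle := Nat.mod_le d (L + 1)
    rw [← Finset.sum_range_sub]
    calc _ ≤ ∑ s ∈ Finset.range (d % (L + 1)), |U i (s + 1) - U i s| :=
          Finset.abs_sum_le_sum_abs _ _
      _ = ∑ s ∈ Finset.range (d % (L + 1)), b i s :=
          Finset.sum_congr rfl fun s hs => by
            have := Finset.mem_range.1 hs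
            simp only [b]; rw [if_pos (by omega)]
      _ ≤ _ := Finset.sum_le_sum_of_subset_of_nonneg
          (Finset.range_mono (by omega)) fun s _ _ => hb i s
  have hsumb : ∀ i N, ∑ d ∈ Finset.range N, b i d ^ 2 ≤
      ∑ j ∈ Finset.range L, (U i (j + 1) - U i j) ^ 2 := by
    intro i N
    have : ∀ d, b i d ^ 2 = if d < L then (U i (d + 1) - U i d) ^ 2 else 0 := fun d => by
      simp only [b]; split_ifs <;> simp
    simp only [this]
    rw [← Finset.sum_filter]
    refine Finset.sum_le_sum_of_subset_of_nonneg (fun d hd => ?_) fun _ _ _ => sq_nonneg _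
    exact Finset.mem_range.2 (Finset.mem_filter.1 hd).2
  -- Three legs, hence the factor 3: down one column, across row `d % (L + 1)`, up the other. The
  -- vertical legs have equal sums after translation, giving 6. As `d` runs through `c` full
  -- periods, each row serves `c` times.
  have hterm : ∀ d : ℕ, (∑ i, (U (i + (d + 1) • e) 0 - U i 0) ^ 2) / ((d : ℝ) + 1) ^ 2 ≤
      6 * ∑ i, ((∑ s ∈ Finset.range (d + 1), b i s) / (d + 1)) ^ 2 +
        3 * ∑ i, (U (i + e) (d % (L + 1)) - U i (d % (L + 1))) ^ 2 := by
    intro d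
    have hpt : ∀ i, (U (i + (d + 1) • e) 0 - U i 0) ^ 2 ≤
        3 * (∑ s ∈ Finset.range (d + 1), b (i + (d + 1) • e) s) ^ 2 +
        3 * (U (i + (d + 1) • e) (d % (L + 1)) - U i (d % (L + 1))) ^ 2 +
        3 * (∑ s ∈ Finset.range (d + 1), b i s) ^ 2 := by
      intro i
      have h1 := sq_le_sq' (abs_le.1 (hvert i d)).1 (abs_le.1 (hvert i d)).2
      have h2 := sq_le_sq' (abs_le.1 (hvert (i + (d + 1) • e) d)).1
        (abs_le.1 (hvert (i + (d + 1) • e) d)).2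
      set x := U (i + (d + 1) • e) 0
      set y := U i 0
      set x' := U (i + (d + 1) • e) (d % (L + 1))
      set y' := U i (d % (L + 1))
      nlinarith [sq_nonneg ((x - x') - (x' - y')), sq_nonneg ((x' - y') - (y' - y)),
        sq_nonneg ((x - x') - (y' - y))]
    have hhor := sum_sq_shift_le (fun i => U i (d % (L + 1))) e (d + 1)
    have hsum := Finset.sum_le_sum fun i (_ : i ∈ Finset.univ) => hpt i
    simp only [Finset.sum_add_distrib, ← Finset.mul_sum] at hsum
    rw [sum_shift (fun i => (∑ s ∈ Finset.range (d + 1), b i s) ^ 2)] at hsum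
    rw [div_le_iff₀ (by positivity)]
    simp only [div_pow, ← Finset.sum_div]
    push_cast at hhor
    rw [add_mul, mul_assoc, div_mul_cancel₀ _ (by positivity)]
    linarith
  calc _ ≤ ∑ d ∈ Finset.range (c * (L + 1)),
        (6 * ∑ i, ((∑ s ∈ Finset.range (d + 1), b i s) / (d + 1)) ^ 2 +
        3 * ∑ i, (U (i + e) (d % (L + 1)) - U i (d % (L + 1))) ^ 2) :=
        Finset.sum_le_sum fun d _ => hterm d
    _ = 6 * ∑ i, ∑ d ∈ Finset.range (c * (L + 1)),
          ((∑ s ∈ Finset.range (d + 1), b i s) / (d + 1)) ^ 2 +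
        3 * (c * ∑ j ∈ Finset.range (L + 1), ∑ i, (U (i + e) j - U i j) ^ 2) := by
        rw [Finset.sum_add_distrib, ← Finset.mul_sum, ← Finset.mul_sum, Finset.sum_comm,
          sum_range_mul_mod (fun j => ∑ i, (U (i + e) j - U i j) ^ 2)]
    _ ≤ 6 * ∑ i, (4 * ∑ j ∈ Finset.range L, (U i (j + 1) - U i j) ^ 2) +
        3 * (c * ∑ j ∈ Finset.range (L + 1), ∑ i, (U (i + e) j - U i j) ^ 2) := by
        gcongr with i
        exact (hardy_inequality (b i) _).trans (by gcongr; exact hsumb i _)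
    _ = _ := by
        rw [← Finset.mul_sum, Finset.sum_comm (s := Finset.univ)]
        ring

/-- The mean of `ψ` over the window `i, i + e, …, i + j • e`. -/
noncomputable def windowMean (ψ : A → ℝ) (e : A) (i : A) (j : ℕ) : ℝ :=
  (∑ s ∈ Finset.range (j + 1), ψ (i + s • e)) / (j + 1)

/-- Two adjacent windows differ only by their end points, so a horizontal difference in row `j` is a
boundary difference at distance `j + 1`. -/
lemma windowMean_shift_sub (ψ : A → ℝ) (e i : A) (j : ℕ) :
    windowMean ψ e (i + e) j - windowMean ψ e i j =
      (ψ (i + (j + 1) • e) - ψ i) / (j + 1) := by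
  have h := Finset.sum_range_sub (fun s => ψ (i + s • e)) (j + 1)
  rw [Finset.sum_sub_distrib] at h
  simp only [zero_smul, add_zero] at h
  rw [windowMean, windowMean, ← sub_div, ← h]
  simp only [succ_nsmul', add_assoc]

lemma windowMean_succ_sub (ψ : A → ℝ) (e i : A) (j : ℕ) :
    windowMean ψ e i (j + 1) - windowMean ψ e i j =
      (∑ s ∈ Finset.range (j + 1), (ψ (i + (j + 1) • e) - ψ (i + s • e))) /
        ((j + 1) * (j + 2)) := by
  rw [windowMean, windowMean, Finset.sum_range_succ _ (j + 1), Finset.sum_sub_distrib]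
  simp only [Finset.sum_const, Finset.card_range, nsmul_eq_mul]
  push_cast
  have h1 : (j : ℝ) + 1 ≠ 0 := by positivity
  have h2 : (j : ℝ) + 2 ≠ 0 := by positivity
  have h3 : (j : ℝ) + 1 + 1 ≠ 0 := by positivity
  field_simp
  ring

lemma sum_sq_windowMean_sub_le [Fintype A] (ψ : A → ℝ) (e : A) (x : ℝ) (j : ℕ) :
    ∑ i, (windowMean ψ e i j - x) ^ 2 ≤ ∑ i, (ψ i - x) ^ 2 := by
  have h1 : ∀ i, (windowMean ψ e i j - x) ^ 2 ≤
      (∑ s ∈ Finset.range (j + 1), (ψ (i + s • e) - x) ^ 2) / (j + 1) := by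
    intro i
    have h : windowMean ψ e i j - x =
        (∑ s ∈ Finset.range (j + 1), (ψ (i + s • e) - x)) / (j + 1) := by
      rw [windowMean, Finset.sum_sub_distrib]
      simp only [Finset.sum_const, Finset.card_range, nsmul_eq_mul]
      push_cast
      field_simp
    have h2 := sq_sum_le_card_mul_sum_sq (s := Finset.range (j + 1))
      (f := fun s => ψ (i + s • e) - x)
    rw [Finset.card_range] at h2
    push_cast at h2
    rw [h, div_pow, div_le_div_iff₀ (by positivity) (by positivity)]
    nlinarith [(by positivity : (0 : ℝ) < (j : ℝ) + 1)]
  calc _ ≤ ∑ i, (∑ s ∈ Finset.range (j + 1), (ψ (i + s • e) - x) ^ 2) / (j + 1) :=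
        Finset.sum_le_sum fun i _ => h1 i
    _ = (∑ s ∈ Finset.range (j + 1), ∑ i, (ψ (i + s • e) - x) ^ 2) / (j + 1) := by
        rw [← Finset.sum_div, Finset.sum_comm]
    _ = _ := by
        simp only [sum_shift (fun i => (ψ i - x) ^ 2), Finset.sum_const, Finset.card_range,
          nsmul_eq_mul]
        push_cast
        field_simp

/-- Lengthening the window moves its mean by the average gap to the new end point, divided by `j +
2`. After Cauchy–Schwarz, translation leaves only the distances `1, …, j + 1`. -/
lemma sum_sq_windowMean_succ_sub_le [Fintype A] (ψ : A → ℝ) (e : A) (j : ℕ) :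
    ∑ i, (windowMean ψ e i (j + 1) - windowMean ψ e i j) ^ 2 ≤
      (∑ t ∈ Finset.range (j + 1), ∑ i, (ψ (i + (t + 1) • e) - ψ i) ^ 2) /
        ((j + 1) * (j + 2) ^ 2) := by
  have h1 : ∀ i, (windowMean ψ e i (j + 1) - windowMean ψ e i j) ^ 2 ≤
      (∑ s ∈ Finset.range (j + 1), (ψ (i + (j + 1) • e) - ψ (i + s • e)) ^ 2) /
        ((j + 1) * (j + 2) ^ 2) := by
    intro i
    have h2 := sq_sum_le_card_mul_sum_sq (s := Finset.range (j + 1))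
      (f := fun s => ψ (i + (j + 1) • e) - ψ (i + s • e))
    rw [Finset.card_range] at h2
    push_cast at h2
    rw [windowMean_succ_sub, div_pow, mul_pow, div_le_div_iff₀ (by positivity) (by positivity)]
    have : (0 : ℝ) < ((j : ℝ) + 1) * (j + 2) ^ 2 := by positivity
    nlinarith [mul_le_mul_of_nonneg_right h2 this.le]
  have h2 : ∀ s ∈ Finset.range (j + 1), ∑ i, (ψ (i + (j + 1) • e) - ψ (i + s • e)) ^ 2 =
      ∑ i, (ψ (i + (j + 1 - 1 - s + 1) • e) - ψ i) ^ 2 := by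
    intro s hs
    have hs := Finset.mem_range.1 hs
    rw [← sum_shift (fun i => (ψ (i + (j + 1 - 1 - s + 1) • e) - ψ i) ^ 2) (s • e)]
    refine Finset.sum_congr rfl fun i _ => ?_
    rw [add_assoc i, ← add_nsmul, show s + (j + 1 - 1 - s + 1) = j + 1 by omega]
  calc _ ≤ ∑ i, (∑ s ∈ Finset.range (j + 1), (ψ (i + (j + 1) • e) - ψ (i + s • e)) ^ 2) /
        ((j + 1) * (j + 2) ^ 2) := Finset.sum_le_sum fun i _ => h1 i
    _ = _ := by
      rw [← Finset.sum_div, Finset.sum_comm, Finset.sum_congr rfl h2,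
        Finset.sum_range_reflect (fun t => ∑ i, (ψ (i + (t + 1) • e) - ψ i) ^ 2) (j + 1)]

/-- The weight is at most half of `1 / (j + 1) ^ 2 - 1 / (j + 2) ^ 2`, so the sum over `j ≥ t`
telescopes; the induction carries the remaining tail term. -/
lemma sum_partial_sums_le (D : ℕ → ℝ) (hD : ∀ t, 0 ≤ D t) (L : ℕ) :
    ∑ j ∈ Finset.range L, (∑ t ∈ Finset.range (j + 1), D t) / (((j : ℝ) + 1) * (j + 2) ^ 2) ≤
      1 / 2 * ∑ t ∈ Finset.range L, D t / ((t : ℝ) + 1) ^ 2 := by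
  suffices h : ∑ j ∈ Finset.range L,
        (∑ t ∈ Finset.range (j + 1), D t) / (((j : ℝ) + 1) * (j + 2) ^ 2) +
      1 / 2 * ((∑ t ∈ Finset.range L, D t) / ((L : ℝ) + 1) ^ 2) ≤
      1 / 2 * ∑ t ∈ Finset.range L, D t / ((t : ℝ) + 1) ^ 2 by
    have : 0 ≤ 1 / 2 * ((∑ t ∈ Finset.range L, D t) / ((L : ℝ) + 1) ^ 2) :=
      mul_nonneg (by norm_num) (div_nonneg (Finset.sum_nonneg fun t _ => hD t) (by positivity))
    linarith
  induction L with
  | zero => simp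
  | succ n ih =>
    rw [Finset.sum_range_succ, Finset.sum_range_succ (fun t => D t / ((t : ℝ) + 1) ^ 2)]
    push_cast
    have hS : ∑ t ∈ Finset.range n, D t = ∑ t ∈ Finset.range (n + 1), D t - D n := by
      rw [Finset.sum_range_succ]; ring
    set S := ∑ t ∈ Finset.range (n + 1), D t
    have hS0 : 0 ≤ S := Finset.sum_nonneg fun t _ => hD t
    rw [hS, sub_div] at ih
    have key : S / (((n : ℝ) + 1) * (n + 2) ^ 2) + 1 / 2 * (S / ((n : ℝ) + 1 + 1) ^ 2) ≤
        1 / 2 * (S / ((n : ℝ) + 1) ^ 2) := by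
      have : 1 / 2 * (S / ((n : ℝ) + 1) ^ 2) - (S / (((n : ℝ) + 1) * (n + 2) ^ 2) +
          1 / 2 * (S / ((n : ℝ) + 1 + 1) ^ 2)) = S / (2 * ((n : ℝ) + 1) ^ 2 * (n + 2) ^ 2) := by
        rw [show (n : ℝ) + 1 + 1 = n + 2 by ring]
        field_simp
        ring
      have : 0 ≤ S / (2 * ((n : ℝ) + 1) ^ 2 * (n + 2) ^ 2) := by positivity
      linarith
    linarith

/-- The extension from the first row of a cylinder with rows `0, …, L`, equal to `x` on the last
one. -/
noncomputable def cylinderExtension (ψ : A → ℝ) (e : A) (x : ℝ) (L : ℕ) (i : A) (j : ℕ) : ℝ :=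
  x + (1 - j / L) * (windowMean ψ e i j - x)

lemma cylinderExtension_zero (ψ : A → ℝ) (e : A) (x : ℝ) (L : ℕ) (i : A) :
    cylinderExtension ψ e x L i 0 = ψ i := by
  simp [cylinderExtension, windowMean]

lemma cylinderExtension_last (ψ : A → ℝ) (e : A) (x : ℝ) {L : ℕ} (hL : L ≠ 0) (i : A) :
    cylinderExtension ψ e x L i L = x := by
  simp [cylinderExtension, hL]

lemma cylinderExtension_horizontal [Fintype A] (ψ : A → ℝ) (e : A) (x : ℝ) (L : ℕ) :
    ∑ j ∈ Finset.range (L + 1), ∑ i,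
        (cylinderExtension ψ e x L (i + e) j - cylinderExtension ψ e x L i j) ^ 2 ≤
      ∑ t ∈ Finset.range (L + 1),
        (∑ i, (ψ (i + (t + 1) • e) - ψ i) ^ 2) / ((t : ℝ) + 1) ^ 2 := by
  refine Finset.sum_le_sum fun j hj => ?_
  rw [Finset.sum_div]
  refine Finset.sum_le_sum fun i _ => ?_
  have h : cylinderExtension ψ e x L (i + e) j - cylinderExtension ψ e x L i j =
      (1 - j / L) * ((ψ (i + (j + 1) • e) - ψ i) / (j + 1)) := by
    rw [← windowMean_shift_sub, cylinderExtension, cylinderExtension]; ring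
  have hjL : (j : ℝ) / L ≤ 1 := div_le_one_of_le₀
    (by exact_mod_cast Nat.lt_succ_iff.1 (Finset.mem_range.1 hj)) (by positivity)
  have hj0 : (0 : ℝ) ≤ j / L := by positivity
  rw [h, mul_pow, div_pow]
  exact mul_le_of_le_one_left (by positivity) (by nlinarith)

/-- By the product rule, the growth of the window costs the boundary sum and the slope `1 / L` of
the cutoff costs the variance about `x`. -/
lemma cylinderExtension_vertical [Fintype A] (ψ : A → ℝ) (e : A) (x : ℝ) {L : ℕ} (hL : L ≠ 0) :
    ∑ j ∈ Finset.range L, ∑ i,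
        (cylinderExtension ψ e x L i (j + 1) - cylinderExtension ψ e x L i j) ^ 2 ≤
      ∑ t ∈ Finset.range (L + 1),
        (∑ i, (ψ (i + (t + 1) • e) - ψ i) ^ 2) / ((t : ℝ) + 1) ^ 2 +
        2 / L * ∑ i, (ψ i - x) ^ 2 := by
  have hL' : (0 : ℝ) < L := by positivity
  have h1 : ∀ j ∈ Finset.range L, ∀ i,
      (cylinderExtension ψ e x L i (j + 1) - cylinderExtension ψ e x L i j) ^ 2 ≤
      2 * (windowMean ψ e i (j + 1) - windowMean ψ e i j) ^ 2 +
        2 / L ^ 2 * (windowMean ψ e i j - x) ^ 2 := by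
    intro j hj i
    have hjL : ((j + 1 : ℕ) : ℝ) / L ≤ 1 := div_le_one_of_le₀
      (by exact_mod_cast Finset.mem_range.1 hj) (by positivity)
    have hj0 : (0 : ℝ) ≤ ((j + 1 : ℕ) : ℝ) / L := by positivity
    have h : cylinderExtension ψ e x L i (j + 1) - cylinderExtension ψ e x L i j =
        (1 - ((j + 1 : ℕ) : ℝ) / L) * (windowMean ψ e i (j + 1) - windowMean ψ e i j) +
          -(1 / L) * (windowMean ψ e i j - x) := by
      rw [cylinderExtension, cylinderExtension]; push_cast; field_simp; ring
    rw [h]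
    refine (add_sq_le).trans ?_
    rw [mul_add, mul_pow, mul_pow]
    have h3 : (1 - ((j + 1 : ℕ) : ℝ) / L) ^ 2 ≤ 1 := by nlinarith
    have h4 := mul_le_of_le_one_left
      (sq_nonneg (windowMean ψ e i (j + 1) - windowMean ψ e i j)) h3
    have h5 : 2 * ((-(1 / (L : ℝ))) ^ 2 * (windowMean ψ e i j - x) ^ 2) =
        2 / L ^ 2 * (windowMean ψ e i j - x) ^ 2 := by field_simp
    rw [h5]
    linarith
  have hD : ∀ t : ℕ, 0 ≤ ∑ i, (ψ (i + (t + 1) • e) - ψ i) ^ 2 := fun t =>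
    Finset.sum_nonneg fun i _ => sq_nonneg _
  calc _ ≤ ∑ j ∈ Finset.range L, ∑ i,
        (2 * (windowMean ψ e i (j + 1) - windowMean ψ e i j) ^ 2 +
        2 / L ^ 2 * (windowMean ψ e i j - x) ^ 2) :=
        Finset.sum_le_sum fun j hj => Finset.sum_le_sum fun i _ => h1 j hj i
    _ = ∑ j ∈ Finset.range L,
        (2 * ∑ i, (windowMean ψ e i (j + 1) - windowMean ψ e i j) ^ 2 +
        2 / L ^ 2 * ∑ i, (windowMean ψ e i j - x) ^ 2) := by
        simp only [Finset.sum_add_distrib, ← Finset.mul_sum]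
    _ ≤ ∑ j ∈ Finset.range L,
        (2 * ((∑ t ∈ Finset.range (j + 1), ∑ i, (ψ (i + (t + 1) • e) - ψ i) ^ 2) /
        ((j + 1) * (j + 2) ^ 2)) + 2 / L ^ 2 * ∑ i, (ψ i - x) ^ 2) := by
        refine Finset.sum_le_sum fun j _ => add_le_add
          (mul_le_mul_of_nonneg_left (sum_sq_windowMean_succ_sub_le ψ e j) zero_le_two)
          (mul_le_mul_of_nonneg_left (sum_sq_windowMean_sub_le ψ e x j) (by positivity))
    _ = 2 * ∑ j ∈ Finset.range L,
        ((∑ t ∈ Finset.range (j + 1), ∑ i, (ψ (i + (t + 1) • e) - ψ i) ^ 2) /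
        ((j + 1) * (j + 2) ^ 2)) + 2 / L * ∑ i, (ψ i - x) ^ 2 := by
        rw [Finset.sum_add_distrib, ← Finset.mul_sum, Finset.sum_const, Finset.card_range,
          nsmul_eq_mul]
        field_simp
    _ ≤ _ := by
        have h2 := sum_partial_sums_le (fun t => ∑ i, (ψ (i + (t + 1) • e) - ψ i) ^ 2) hD L
        have h3 : 0 ≤ (∑ i, (ψ (i + (L + 1) • e) - ψ i) ^ 2) / ((L : ℝ) + 1) ^ 2 :=
          div_nonneg (hD L) (by positivity)
        rw [Finset.sum_range_succ _ L]
        linarith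

end Cylinder

/-! ### Quadratic forms as double sums over ordered pairs -/

section Forms

/-- Twice the Dirichlet form of a graph. -/
def dirichlet {V : Type*} [Fintype V] (G : SimpleGraph V) [DecidableRel G.Adj] (u : V → ℝ) : ℝ :=
  ∑ v, ∑ w, if G.Adj v w then (u v - u w) ^ 2 else 0

lemma energy_eq {V : Type*} [Fintype V] [DecidableEq V] (G : SimpleGraph V) [DecidableRel G.Adj]
    (u : V → ℝ) : energy G u = √(dirichlet G u / 2) := by
  rw [energy, dirichlet, ← SimpleGraph.lapMatrix_toLinearMap₂', Matrix.toLinearMap₂'_apply',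
    dotProduct_comm]

lemma weightedLaplacian_form {ι : Type*} [Fintype ι] [DecidableEq ι] (w : ι → ι → ℝ)
    (hw : ∀ p q, w p q = w q p) (φ : ι → ℝ) :
    (weightedLaplacian w *ᵥ φ) ⬝ᵥ φ = (∑ p, ∑ q, w p q * (φ p - φ q) ^ 2) / 2 := by
  have h1 : ∀ p, (weightedLaplacian w *ᵥ φ) p = ∑ q, w p q * (φ p - φ q) := by
    intro p
    rw [Matrix.mulVec, dotProduct, ← Finset.add_sum_erase _ _ (Finset.mem_univ p),
      ← Finset.add_sum_erase _ (fun q => w p q * (φ p - φ q)) (Finset.mem_univ p)]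
    have : ∀ q ∈ Finset.univ.erase p, weightedLaplacian w p q * φ q = -(w p q * φ q) := by
      intro q hq
      have : p ≠ q := (Finset.ne_of_mem_erase hq).symm
      simp [weightedLaplacian, this]
    rw [Finset.sum_congr rfl this, Finset.sum_neg_distrib]
    simp only [weightedLaplacian, Matrix.of_apply, if_true, mul_sub, Finset.sum_sub_distrib,
      sub_self, Finset.sum_mul]
    ring
  have h2 : ∑ p, ∑ q, w p q * (φ p - φ q) * φ p = ∑ p, ∑ q, w p q * (φ q - φ p) * φ q := by
    rw [Finset.sum_comm]
    exact Finset.sum_congr rfl fun p _ => Finset.sum_congr rfl fun q _ => by rw [hw q p]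
  have h3 : ∑ p, ∑ q, w p q * (φ p - φ q) ^ 2 =
      ∑ p, ∑ q, w p q * (φ p - φ q) * φ p + ∑ p, ∑ q, w p q * (φ q - φ p) * φ q := by
    simp only [← Finset.sum_add_distrib]
    exact Finset.sum_congr rfl fun p _ => Finset.sum_congr rfl fun q _ => by ring
  simp only [dotProduct, h1, Finset.sum_mul]
  rw [h3, ← h2]
  ring

/-- Twice the quadratic form of the boundary Laplacian. -/
noncomputable def boundaryForm {V : Type*} (G : SimpleGraph V) (Γ : Finset V)
    (φ : {v // v ∈ Γ} → ℝ) : ℝ :=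
  ∑ p : {v // v ∈ Γ}, ∑ q : {v // v ∈ Γ},
    ((((G.induce {v | v ∈ Γ}).dist p q : ℕ) : ℝ) ^ 2)⁻¹ * (φ p - φ q) ^ 2

lemma boundaryLaplacian_form {V : Type*} [DecidableEq V] (G : SimpleGraph V) (Γ : Finset V)
    (φ : {v // v ∈ Γ} → ℝ) :
    (boundaryLaplacian G Γ *ᵥ φ) ⬝ᵥ φ = boundaryForm G Γ φ / 2 := by
  rw [boundaryLaplacian, weightedLaplacian_form _ (fun p q => by rw [SimpleGraph.dist_comm]),
    boundaryForm]

lemma dirichlet_nonneg {V : Type*} [Fintype V] (G : SimpleGraph V) [DecidableRel G.Adj]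
    (u : V → ℝ) : 0 ≤ dirichlet G u :=
  Finset.sum_nonneg fun v _ => Finset.sum_nonneg fun w _ => by split_ifs <;> positivity

lemma boundaryForm_nonneg {V : Type*} (G : SimpleGraph V) (Γ : Finset V)
    (φ : {v // v ∈ Γ} → ℝ) : 0 ≤ boundaryForm G Γ φ :=
  Finset.sum_nonneg fun v _ => Finset.sum_nonneg fun w _ => by positivity

end Forms

/-! ### Differences bounded by energy along a path -/

section Path

variable {V : Type*} {G : SimpleGraph V}

/-- The squared increment of `u` along an edge. -/
def edgeSq (u : V → ℝ) : Sym2 V → ℝ :=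
  Sym2.lift ⟨fun v w => (u v - u w) ^ 2, fun v w => by ring⟩

lemma two_mul_sum_edgeSq [Fintype V] [DecidableEq V] [DecidableRel G.Adj] (u : V → ℝ) :
    2 * ∑ e ∈ G.edgeFinset, edgeSq u e = dirichlet G u := by
  have h1 : ∑ d : G.Dart, edgeSq u d.edge = 2 * ∑ e ∈ G.edgeFinset, edgeSq u e := by
    rw [← Finset.sum_fiberwise_of_maps_to (s := Finset.univ) (t := G.edgeFinset)
      (g := fun d : G.Dart => d.edge) (fun d _ => SimpleGraph.mem_edgeFinset.2 d.edge_mem),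
      Finset.mul_sum]
    refine Finset.sum_congr rfl fun e he => ?_
    rw [Finset.sum_congr rfl (g := fun _ => edgeSq u e)
      (fun d hd => by rw [(Finset.mem_filter.1 hd).2]), Finset.sum_const, nsmul_eq_mul]
    have := SimpleGraph.dart_edge_fiber_card (G := G) e (SimpleGraph.mem_edgeFinset.1 he)
    rw [this]; norm_num
  rw [← h1, dirichlet, ← Finset.sum_product', ← Finset.sum_filter]
  refine Finset.sum_bij (fun d _ => d.toProd) (fun d _ => ?_) (fun d _ d' _ h => ?_)
    (fun x hx => ?_) (fun d _ => rfl)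
  · simp
  · exact SimpleGraph.Dart.ext _ _ h
  · exact ⟨⟨x, (Finset.mem_filter.1 hx).2⟩, Finset.mem_univ _, rfl⟩

/-- The cross term of Cauchy–Schwarz when a path of `n` edges with energy `s` is prolonged by one
edge; valid also for `n = 0`. -/
lemma two_mul_mul_le {x y n s : ℝ} (hn : 0 ≤ n) (hs : 0 ≤ s) (h : y ^ 2 ≤ n * s) :
    2 * x * y ≤ n * x ^ 2 + s := by
  refine le_of_abs_le (abs_le_of_sq_le_sq ?_ (by positivity))
  nlinarith [sq_nonneg (n * x ^ 2 - s), mul_le_mul_of_nonneg_left h (sq_nonneg x)]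

lemma sq_sub_le_length_mul (u : V → ℝ) {v w : V} (p : G.Walk v w) :
    (u v - u w) ^ 2 ≤ p.length * (p.edges.map (edgeSq u)).sum ∧
      0 ≤ (p.edges.map (edgeSq u)).sum := by
  induction p with
  | nil => simp
  | @cons x y z h p ih =>
    obtain ⟨h1, h2⟩ := ih
    rw [SimpleGraph.Walk.length_cons, SimpleGraph.Walk.edges_cons, List.map_cons, List.sum_cons]
    have he : edgeSq u s(x, y) = (u x - u y) ^ 2 := rfl
    rw [he]
    push_cast
    refine ⟨?_, by positivity⟩
    have := two_mul_mul_le (x := u x - u y) (Nat.cast_nonneg p.length) h2 h1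
    nlinarith

lemma two_mul_sq_sub_le [Fintype V] [DecidableRel G.Adj] (hG : G.Connected) {M : ℕ}
    (hM : Fintype.card V ≤ M) (u : V → ℝ) (v w : V) :
    2 * (u v - u w) ^ 2 ≤ ((M : ℝ) - 1) * dirichlet G u := by
  classical
  obtain ⟨p, hp⟩ := (hG.preconnected v w).exists_isPath
  have hlen : (p.length : ℝ) + 1 ≤ M := by exact_mod_cast hp.length_lt.trans_le hM
  have h1 : (p.edges.map (edgeSq u)).sum = ∑ e ∈ p.edges.toFinset, edgeSq u e :=
    (List.sum_toFinset _ hp.isTrail.edges_nodup).symm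
  have hnn : ∀ e, 0 ≤ edgeSq u e := fun e => by
    induction e with
    | _ x y => exact sq_nonneg _
  have h2 : ∑ e ∈ p.edges.toFinset, edgeSq u e ≤ ∑ e ∈ G.edgeFinset, edgeSq u e := by
    refine Finset.sum_le_sum_of_subset_of_nonneg (fun e he => ?_) fun e _ _ => hnn e
    exact SimpleGraph.mem_edgeFinset.2 (p.edges_subset_edgeSet (List.mem_toFinset.1 he))
  have h3 := (sq_sub_le_length_mul u p).1
  have h4 : 0 ≤ ∑ e ∈ G.edgeFinset, edgeSq u e := Finset.sum_nonneg fun e _ => hnn e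
  rw [← two_mul_sum_edgeSq]
  rw [h1] at h3
  have h5 : (p.length : ℝ) * ∑ e ∈ p.edges.toFinset, edgeSq u e ≤
      ((M : ℝ) - 1) * ∑ e ∈ G.edgeFinset, edgeSq u e :=
    mul_le_mul (by linarith) h2 (Finset.sum_nonneg fun e _ => hnn e) (by
      have : (0 : ℝ) ≤ p.length := Nat.cast_nonneg _
      linarith)
  linarith

end Path

/-! ### Energy between cells and their representatives -/

section Blocks

variable {V X : Type*} [Fintype X] {G : SimpleGraph V} [DecidableRel G.Adj]
  {a : X → Finset V}

lemma sum_comp_le_of_injective {ι : Type*} [Fintype ι] {x : ι → X} (hx : x.Injective) (g : X → ℝ)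
    (hg : ∀ z, 0 ≤ g z) : ∑ i, g (x i) ≤ ∑ z, g z := by
  refine (Finset.sum_map Finset.univ ⟨x, hx⟩ g).symm.le.trans ?_
  exact Finset.sum_le_sum_of_subset_of_nonneg (Finset.subset_univ _) fun z _ _ => hg z

lemma sum_blocks_le [Fintype V] (ha : ∀ x y, x ≠ y → Disjoint (a x) (a y)) (g : V → ℝ)
    (hg : ∀ v, 0 ≤ g v) : ∑ x, ∑ v ∈ a x, g v ≤ ∑ v, g v := by
  classical
  rw [← Finset.sum_biUnion fun x _ y _ h => ha x y h]
  exact Finset.sum_le_sum_of_subset_of_nonneg (Finset.subset_univ _) fun v _ _ => hg v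

/-- The part of the Dirichlet form carried by the edges between two sets. -/
def blockForm (G : SimpleGraph V) [DecidableRel G.Adj] (u : V → ℝ) (S T : Finset V) : ℝ :=
  ∑ v ∈ S, ∑ w ∈ T, if G.Adj v w then (u v - u w) ^ 2 else 0

lemma ite_adj_nonneg (u : V → ℝ) (v w : V) :
    0 ≤ if G.Adj v w then (u v - u w) ^ 2 else 0 := by
  split_ifs <;> positivity

lemma blockForm_nonneg (u : V → ℝ) (S T : Finset V) : 0 ≤ blockForm G u S T :=
  Finset.sum_nonneg fun v _ => Finset.sum_nonneg fun w _ => ite_adj_nonneg u v w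

lemma sum_blockForm_le [Fintype V] (ha : ∀ x y, x ≠ y → Disjoint (a x) (a y)) (u : V → ℝ) :
    ∑ x, ∑ y, blockForm G u (a x) (a y) ≤ dirichlet G u := by
  have h1 : ∀ x, ∑ y, blockForm G u (a x) (a y) ≤
      ∑ v ∈ a x, ∑ w, if G.Adj v w then (u v - u w) ^ 2 else 0 := by
    intro x
    simp only [blockForm]
    rw [Finset.sum_comm]
    exact Finset.sum_le_sum fun v _ => sum_blocks_le ha _ fun w => ite_adj_nonneg u v w
  exact (Finset.sum_le_sum fun x _ => h1 x).trans (sum_blocks_le ha _ fun v =>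
    Finset.sum_nonneg fun w _ => ite_adj_nonneg u v w)

lemma two_mul_sq_sub_le_blockForm {S : Finset V} (hS : (G.induce {v | v ∈ S}).Connected) {M : ℕ}
    (hM : S.card ≤ M) (u : V → ℝ) {v w : V} (hv : v ∈ S) (hw : w ∈ S) :
    2 * (u v - u w) ^ 2 ≤ ((M : ℝ) - 1) * blockForm G u S S := by
  classical
  have h := two_mul_sq_sub_le hS (M := M) (by simpa using hM)
    (fun x => u x) ⟨v, hv⟩ ⟨w, hw⟩
  have h2 : dirichlet (G.induce {v | v ∈ S}) (fun x => u x) = blockForm G u S S := by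
    have hsum : ∀ F : V → ℝ, ∑ x : ({v | v ∈ S} : Set V), F x = ∑ v ∈ S, F v := fun F =>
      (Finset.sum_subtype S (fun x => Iff.rfl) F).symm
    rw [dirichlet, blockForm, ← hsum]
    refine Finset.sum_congr rfl fun x _ => ?_
    rw [← hsum]
    rfl
  rw [h2] at h
  exact h

/-- The energy of a choice of representatives, along edges with distinct sources and distinct
targets. -/
lemma sum_sq_representatives_le [Fintype V] (ha : ∀ x y, x ≠ y → Disjoint (a x) (a y))
    (hconn : ∀ x, (G.induce {v | v ∈ a x}).Connected) {M : ℕ} (hM1 : 1 ≤ M)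
    (hM : ∀ x, (a x).card ≤ M) (u : V → ℝ) {r : X → V} (hr : ∀ x, r x ∈ a x) {ι : Type*} [Fintype ι] {x y : ι → X}
    (hx : x.Injective) (hy : y.Injective) (hxy : ∀ i, x i ≠ y i)
    (hadj : ∀ i, ∃ v ∈ a (x i), ∃ w ∈ a (y i), G.Adj v w) :
    ∑ i, (u (r (x i)) - u (r (y i))) ^ 2 ≤ 3 / 2 * (2 * M - 1) * dirichlet G u := by
  classical
  set ε : X → X → ℝ := fun x y => blockForm G u (a x) (a y) with hε
  have hε0 : ∀ x y, 0 ≤ ε x y := fun x y => blockForm_nonneg u _ _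
  have hM1 : (1 : ℝ) ≤ M := by exact_mod_cast hM1
  -- A route between representatives has at most `M - 1` edges in each cell and one between them, `2
  -- * M - 1` in all. Inner edges appear twice in `ε z z`, hence the halves; the half for the source
  -- cell is enlarged to 1 so that it joins the sum over `z`.
  have hpt : ∀ i, (u (r (x i)) - u (r (y i))) ^ 2 ≤
      (2 * M - 1) * (1 / 2 * ε (y i) (y i) + ∑ z, ε (x i) z) := by
    intro i
    obtain ⟨v, hv, w, hw, hvw⟩ := hadj i
    have h1 := two_mul_sq_sub_le_blockForm (hconn (x i)) (hM _) u (hr (x i)) hv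
    have h2 := two_mul_sq_sub_le_blockForm (hconn (y i)) (hM _) u hw (hr (y i))
    have h3 : (u v - u w) ^ 2 ≤ ε (x i) (y i) := by
      have e1 : (if G.Adj v w then (u v - u w) ^ 2 else 0) ≤
          ∑ w ∈ a (y i), if G.Adj v w then (u v - u w) ^ 2 else 0 :=
        Finset.single_le_sum (f := fun w => if G.Adj v w then (u v - u w) ^ 2 else 0)
          (fun w _ => ite_adj_nonneg u v w) hw
      rw [if_pos hvw] at e1
      exact e1.trans (Finset.single_le_sum
        (f := fun v => ∑ w ∈ a (y i), if G.Adj v w then (u v - u w) ^ 2 else 0)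
        (fun v _ => Finset.sum_nonneg fun w _ => ite_adj_nonneg u v w) hv)
    have h4 : ε (x i) (x i) + ε (x i) (y i) ≤ ∑ z, ε (x i) z := by
      rw [← Finset.sum_pair (hxy i) (f := fun z => ε (x i) z)]
      exact Finset.sum_le_sum_of_subset_of_nonneg (Finset.subset_univ _) fun z _ _ => hε0 _ _
    have k1 : 0 ≤ ε (x i) (x i) := hε0 _ _
    have k2 : 0 ≤ ε (y i) (y i) := hε0 _ _
    change 2 * _ ≤ ((M : ℝ) - 1) * ε (x i) (x i) at h1
    change 2 * _ ≤ ((M : ℝ) - 1) * ε (y i) (y i) at h2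
    set N : ℝ := (M : ℝ) - 1
    have hN : 0 ≤ N := by simp only [N]; linarith
    set α := u (r (x i)) - u v
    set β := u v - u w
    set γ := u w - u (r (y i))
    have e : u (r (x i)) - u (r (y i)) = α + β + γ := by simp only [α, β, γ]; ring
    have m1 := two_mul_mul_le (x := β) (y := α) (n := N) (s := 1 / 2 * ε (x i) (x i)) hN
      (by positivity) (by linarith)
    have m2 := two_mul_mul_le (x := β) (y := γ) (n := N) (s := 1 / 2 * ε (y i) (y i)) hN
      (by positivity) (by linarith)
    have m3 : 2 * α * γ ≤ α ^ 2 + γ ^ 2 := two_mul_le_add_sq α γ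
    have m4 : (α + β + γ) ^ 2 ≤
        (2 * N + 1) * (1 / 2 * ε (y i) (y i) + (1 / 2 * ε (x i) (x i) + ε (x i) (y i))) := by
      have m5 := mul_le_mul_of_nonneg_left h3 (show 0 ≤ 2 * N + 1 by linarith)
      nlinarith
    rw [e, show (2 : ℝ) * M - 1 = 2 * N + 1 by simp only [N]; ring]
    refine m4.trans (mul_le_mul_of_nonneg_left ?_ (by linarith))
    linarith
  have hdiag : ∑ i, ε (y i) (y i) ≤ dirichlet G u :=
    (sum_comp_le_of_injective hy (fun z => ε z z) fun z => hε0 z z).trans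
      ((Finset.sum_le_sum fun z _ => Finset.single_le_sum (f := fun z' => ε z z')
        (fun z' _ => hε0 z z') (Finset.mem_univ z)).trans (sum_blockForm_le ha u))
  have hsrc : ∑ i, ∑ z, ε (x i) z ≤ dirichlet G u :=
    (sum_comp_le_of_injective hx (fun z' => ∑ z, ε z' z)
      fun z' => Finset.sum_nonneg fun z _ => hε0 z' z).trans (sum_blockForm_le ha u)
  calc _ ≤ ∑ i, (2 * M - 1) * (1 / 2 * ε (y i) (y i) + ∑ z, ε (x i) z) :=
        Finset.sum_le_sum fun i _ => hpt i
    _ = (2 * M - 1) * (1 / 2 * ∑ i, ε (y i) (y i) + ∑ i, ∑ z, ε (x i) z) := by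
        rw [← Finset.mul_sum, Finset.sum_add_distrib, ← Finset.mul_sum]
    _ ≤ (2 * M - 1) * (3 / 2 * dirichlet G u) :=
        mul_le_mul_of_nonneg_left (by linarith) (by linarith)
    _ = _ := by ring

end Blocks

/-! ### Sums over pairs of boundary vertices, column by column -/

section Fibers

variable {P A : Type*} [Fintype P] [DecidableEq A] {C : P → A} {M : ℕ}

lemma sum_comp_le_mul_sum [Fintype A]
    (hM : ∀ j, (Finset.univ.filter fun q => C q = j).card ≤ M) (g : A → ℝ)
    (hg : ∀ i, 0 ≤ g i) : ∑ p, g (C p) ≤ M * ∑ i, g i := by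
  rw [← Finset.sum_fiberwise Finset.univ C, Finset.mul_sum]
  refine Finset.sum_le_sum fun i _ => ?_
  rw [Finset.sum_congr rfl (g := fun _ => g i)
    (fun p hp => by rw [(Finset.mem_filter.1 hp).2]), Finset.sum_const, nsmul_eq_mul]
  exact mul_le_mul_of_nonneg_right (by exact_mod_cast hM i) (hg i)

lemma sum_fiber_const_le (hM : ∀ j, (Finset.univ.filter fun q => C q = j).card ≤ M) (j : A) {x : ℝ}
    (hx : 0 ≤ x) : ∑ q, (if C q = j then x else 0) ≤ M * x := by
  rw [← Finset.sum_filter, Finset.sum_const, nsmul_eq_mul]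
  exact mul_le_mul_of_nonneg_right (by exact_mod_cast hM j) hx

/-- Each difference is routed through the column values `g`. Every vertex has at most `M` partners
in a given column, and the middle leg is counted at most `M ^ 2` times. -/
lemma sum_sq_pairs_le [Fintype A] [AddCommGroup A]
    (hM : ∀ j, (Finset.univ.filter fun q => C q = j).card ≤ M) (f : P → ℝ) (g : A → ℝ) (t : A) :
    ∑ p, ∑ q, (if C q = C p + t then (f p - f q) ^ 2 else 0) ≤
      6 * M * ∑ p, (f p - g (C p)) ^ 2 + 3 * M ^ 2 * ∑ i, (g (i + t) - g i) ^ 2 := by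
  have h1 : ∀ p q, (if C q = C p + t then (f p - f q) ^ 2 else 0) ≤
      3 * (if C q = C p + t then (f p - g (C p)) ^ 2 else 0) +
      3 * (if C q = C p + t then (g (C p + t) - g (C p)) ^ 2 else 0) +
      3 * (if C p = C q - t then (f q - g (C q)) ^ 2 else 0) := by
    intro p q
    by_cases h : C q = C p + t
    · have h' : C p = C q - t := by rw [h]; abel
      rw [if_pos h, if_pos h, if_pos h, if_pos h', h]
      set x := f p
      set y := f q
      set x' := g (C p)
      set y' := g (C p + t)
      nlinarith [sq_nonneg ((x - x') - (x' - y')), sq_nonneg ((x' - y') - (y' - y)),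
        sq_nonneg ((x - x') - (y' - y))]
    · have h' : ¬C p = C q - t := fun hc => h (by rw [hc]; abel)
      rw [if_neg h, if_neg h, if_neg h, if_neg h']
      simp
  have k1 : ∑ p, ∑ q, (if C q = C p + t then (f p - g (C p)) ^ 2 else 0) ≤
      M * ∑ p, (f p - g (C p)) ^ 2 := by
    rw [Finset.mul_sum]
    exact Finset.sum_le_sum fun p _ => sum_fiber_const_le hM _ (sq_nonneg _)
  have k2 : ∑ p, ∑ q, (if C q = C p + t then (g (C p + t) - g (C p)) ^ 2 else 0) ≤
      M * (M * ∑ i, (g (i + t) - g i) ^ 2) := by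
    calc _ ≤ ∑ p, M * (g (C p + t) - g (C p)) ^ 2 :=
          Finset.sum_le_sum fun p _ => sum_fiber_const_le hM _ (sq_nonneg _)
      _ ≤ _ := by
          rw [← Finset.mul_sum]
          exact mul_le_mul_of_nonneg_left
            (sum_comp_le_mul_sum hM (fun i => (g (i + t) - g i) ^ 2) fun i => sq_nonneg _)
            (Nat.cast_nonneg M)
  have k3 : ∑ p, ∑ q, (if C p = C q - t then (f q - g (C q)) ^ 2 else 0) ≤
      M * ∑ p, (f p - g (C p)) ^ 2 := by
    rw [Finset.sum_comm, Finset.mul_sum]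
    exact Finset.sum_le_sum fun p _ => sum_fiber_const_le hM _ (sq_nonneg _)
  have h2 := Finset.sum_le_sum fun p (_ : p ∈ Finset.univ) =>
    Finset.sum_le_sum fun q (_ : q ∈ Finset.univ) => h1 p q
  simp only [Finset.sum_add_distrib, ← Finset.mul_sum] at h2
  linarith

end Fibers

lemma sum_inv_sq_le_two (N : ℕ) : ∑ d ∈ Finset.range N, 1 / ((d : ℝ) + 1) ^ 2 ≤ 2 := by
  have h : ∑ d ∈ Finset.range (N + 1), 1 / ((d : ℝ) + 1) ^ 2 ≤ 2 - 1 / ((N : ℝ) + 1) := by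
    induction N with
    | zero => norm_num
    | succ n ih =>
      rw [Finset.sum_range_succ]
      push_cast
      have : 1 / ((n : ℝ) + 1) - 1 / ((n : ℝ) + 1 + 1) - 1 / ((n : ℝ) + 1 + 1) ^ 2 =
          1 / ((n + 1) * ((n : ℝ) + 1 + 1) ^ 2) := by
        field_simp
        ring
      have : 0 ≤ 1 / ((n + 1) * ((n : ℝ) + 1 + 1) ^ 2) := by positivity
      linarith
  rw [Finset.sum_range_succ] at h
  have : 0 ≤ 1 / ((N : ℝ) + 1) := by positivity
  have : 0 ≤ 1 / ((N : ℝ) + 1) ^ 2 := by positivity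
  linarith

/-- Two elements of a cycle differ by at most half of its length. -/
lemma exists_nsmul_le_half {n : ℕ} (i j : Fin (n + 2)) :
    ∃ e : ℕ, 2 * e ≤ n + 2 ∧ (j = i + e • 1 ∨ i = j + e • 1) := by
  by_cases h : 2 * (j - i).val ≤ n + 2
  · exact ⟨_, h, Or.inl (by rw [val_nsmul_one_self]; abel)⟩
  · refine ⟨(i - j).val, ?_, Or.inr (by rw [val_nsmul_one_self]; abel)⟩
    have h1 : j - i ≠ 0 := fun h0 => h (by rw [h0]; simp)
    have h2 := Fin.val_neg (j - i)
    rw [if_neg h1, neg_sub] at h2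
    omega

/-! ### The trace inequality on the aggregated graph -/

namespace IsAggregationPartition

variable {V : Type*} {G : SimpleGraph V} {Γ : Finset V} {M n m : ℕ}
  {H : SimpleGraph (Fin (n + 2) × Fin (m + 2))} {a : Fin (n + 2) × Fin (m + 2) → Finset V}
  {aStar : Finset V} {C : V → Fin (n + 2)}

/-- Each edge of the walk moves the column by `-1`, `0` or `1`; `s` and `t` count the steps forward
and backward. -/
lemma exists_nsmul_of_walk (hP : IsAggregationPartition G Γ M H a aStar)
    (hstar : H ≤ gridStar (n + 2) (m + 2)) (hC : ∀ v ∈ Γ, v ∈ a (C v, 0))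
    {p q : ({v | v ∈ Γ} : Set V)} (w : (G.induce {v | v ∈ Γ}).Walk p q) :
    ∃ s t : ℕ, s + t ≤ w.length ∧ C p + s • 1 = C q + t • 1 := by
  induction w with
  | nil => exact ⟨0, 0, le_rfl, rfl⟩
  | @cons x y z h w ih =>
    obtain ⟨s, t, hst, he⟩ := ih
    have hxy : G.Adj x y := h
    rw [SimpleGraph.Walk.length_cons]
    rcases hP.column_adj hstar (hC x x.2) (hC y y.2) hxy with h | h | h
    · exact ⟨s, t, by omega, by rw [← h, he]⟩
    · exact ⟨s + 1, t, by omega, by rw [← he, h, succ_nsmul]; abel⟩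
    · exact ⟨s, t + 1, by omega, by rw [h, succ_nsmul, ← add_assoc, ← he]; abel⟩

lemma exists_nsmul_le_dist (hP : IsAggregationPartition G Γ M H a aStar)
    (hstar : H ≤ gridStar (n + 2) (m + 2)) (hC : ∀ v ∈ Γ, v ∈ a (C v, 0))
    (hΓ : (G.induce {v | v ∈ Γ}).Preconnected) (p q : {v // v ∈ Γ}) :
    ∃ e : ℕ, e ≤ (G.induce {v | v ∈ Γ}).dist p q ∧ 2 * e ≤ n + 2 ∧
      (C q = C p + e • 1 ∨ C p = C q + e • 1) := by
  obtain ⟨w, hw⟩ := (hΓ p q).exists_walk_length_eq_dist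
  obtain ⟨s, t, hst, he⟩ := hP.exists_nsmul_of_walk hstar hC w
  obtain ⟨e, he1, he2⟩ := exists_nsmul_le_half (C p) (C q)
  by_cases hcase : e ≤ (G.induce {v | v ∈ Γ}).dist p q
  · exact ⟨e, hcase, he1, he2⟩
  -- Here the net displacement of the walk is at most the distance, which is below `e`, so it also
  -- satisfies the half-length bound.
  · rcases le_total s t with h | h
    · refine ⟨t - s, by omega, by omega, Or.inr ?_⟩
      obtain ⟨r, rfl⟩ := Nat.exists_eq_add_of_le h
      rw [add_nsmul, add_comm (s • 1), ← add_assoc] at he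
      rw [Nat.add_sub_cancel_left]
      exact add_right_cancel he
    · refine ⟨s - t, by omega, by omega, Or.inl ?_⟩
      obtain ⟨r, rfl⟩ := Nat.exists_eq_add_of_le h
      rw [add_nsmul, add_comm (t • 1), ← add_assoc] at he
      rw [Nat.add_sub_cancel_left]
      exact (add_right_cancel he).symm

lemma card_column_le (hP : IsAggregationPartition G Γ M H a aStar)
    (hC : ∀ v ∈ Γ, v ∈ a (C v, 0)) (j : Fin (n + 2)) :
    (Finset.univ.filter fun q : {v // v ∈ Γ} => C q = j).card ≤ M := by
  classical
  refine le_trans ?_ (hP.card_le (j, 0))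
  refine Finset.card_le_card_of_injOn (fun q => q.1) (fun q hq => ?_) Subtype.val_injective.injOn
  have h := hC q q.2
  rw [(Finset.mem_filter.1 hq).2] at h
  exact h

lemma one_le_bound (hP : IsAggregationPartition G Γ M H a aStar) : 1 ≤ M := by
  obtain ⟨v, -, hv⟩ := hP.boundary_meets 0 0 rfl
  exact (Finset.card_pos.2 ⟨v, hv⟩).trans_le (hP.card_le _)

/-- The boundary form in terms of the differences between columns. -/
lemma boundaryForm_le_columns (hP : IsAggregationPartition G Γ M H a aStar)
    (hstar : H ≤ gridStar (n + 2) (m + 2)) (hC : ∀ v ∈ Γ, v ∈ a (C v, 0))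
    (hΓ : (G.induce {v | v ∈ Γ}).Preconnected) {N : ℕ} (hN : n + 2 < 2 * N)
    (φ : {v // v ∈ Γ} → ℝ) (g : Fin (n + 2) → ℝ) :
    boundaryForm G Γ φ ≤ 30 * M * ∑ p, (φ p - g (C p)) ^ 2 +
      6 * M ^ 2 * ∑ d ∈ Finset.range N,
        (∑ i, (g (i + (d + 1) • 1) - g i) ^ 2) / ((d : ℝ) + 1) ^ 2 := by
  -- A pair whose columns differ by `e` has boundary distance at least `e`. The case `e = 0` is the
  -- separate first term; for `e = d + 1`, `hN` guarantees `d < N`.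
  have hpt : ∀ p q : {v // v ∈ Γ},
      ((((G.induce {v | v ∈ Γ}).dist p q : ℕ) : ℝ) ^ 2)⁻¹ * (φ p - φ q) ^ 2 ≤
      (if C q = C p + 0 then (φ p - φ q) ^ 2 else 0) +
      ∑ d ∈ Finset.range N, ((if C q = C p + (d + 1) • 1 then (φ p - φ q) ^ 2 else 0) +
        (if C p = C q + (d + 1) • 1 then (φ q - φ p) ^ 2 else 0)) * (1 / ((d : ℝ) + 1) ^ 2) := by
    intro p q
    have hterm : ∀ d : ℕ, 0 ≤ ((if C q = C p + (d + 1) • 1 then (φ p - φ q) ^ 2 else 0) +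
        (if C p = C q + (d + 1) • 1 then (φ q - φ p) ^ 2 else 0)) * (1 / ((d : ℝ) + 1) ^ 2) := by
      intro d
      split_ifs <;> positivity
    obtain ⟨e, h1, h2, h3⟩ := hP.exists_nsmul_le_dist hstar hC hΓ p q
    rcases Nat.eq_zero_or_pos e with rfl | he
    · have h4 : C q = C p + 0 := by
        rcases h3 with h | h
        · simpa using h
        · simpa using h.symm
      rw [if_pos h4]
      have h5 : ((((G.induce {v | v ∈ Γ}).dist p q : ℕ) : ℝ) ^ 2)⁻¹ ≤ 1 := by
        rcases Nat.eq_zero_or_pos ((G.induce {v | v ∈ Γ}).dist p q) with h | h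
        · rw [h]; simp
        · exact inv_le_one_of_one_le₀ (one_le_pow₀ (by exact_mod_cast h))
      have := mul_le_of_le_one_left (sq_nonneg (φ p - φ q)) h5
      have h6 := Finset.sum_nonneg fun d (_ : d ∈ Finset.range N) => hterm d
      linarith
    · obtain ⟨d, rfl⟩ : ∃ d, e = d + 1 := ⟨e - 1, by omega⟩
      have h4 := Finset.single_le_sum (fun d _ => hterm d) (Finset.mem_range.2
        (show d < N by omega))
      refine le_trans ?_ (le_trans h4 (le_add_of_nonneg_left (by split_ifs <;> positivity)))
      have h5 : ((((G.induce {v | v ∈ Γ}).dist p q : ℕ) : ℝ) ^ 2)⁻¹ ≤ 1 / ((d : ℝ) + 1) ^ 2 := by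
        rw [← one_div]
        refine one_div_le_one_div_of_le (by positivity) ?_
        gcongr
        exact_mod_cast h1
      rw [mul_comm]
      refine mul_le_mul ?_ h5 (by positivity) (by split_ifs <;> positivity)
      rcases h3 with h | h
      · rw [if_pos h]
        exact le_add_of_nonneg_right (by split_ifs <;> positivity)
      · rw [if_pos h, show (φ p - φ q) ^ 2 = (φ q - φ p) ^ 2 by ring]
        exact le_add_of_nonneg_left (by split_ifs <;> positivity)
  have hM := hP.card_column_le hC
  set Dev := ∑ p, (φ p - g (C p)) ^ 2 with hDev
  have hDev0 : 0 ≤ Dev := Finset.sum_nonneg fun p _ => sq_nonneg _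
  set D : ℕ → ℝ := fun d => ∑ i, (g (i + (d + 1) • 1) - g i) ^ 2 with hD
  have h0 := sum_sq_pairs_le (C := fun p : {v // v ∈ Γ} => C p) hM φ g 0
  have h0' : ∑ i, (g (i + 0) - g i) ^ 2 = 0 := by simp
  rw [h0', mul_zero, add_zero, ← hDev] at h0
  have hd : ∀ d : ℕ, ∑ p : {v // v ∈ Γ}, ∑ q : {v // v ∈ Γ},
      ((if C q = C p + (d + 1) • 1 then (φ p - φ q) ^ 2 else 0) +
        (if C p = C q + (d + 1) • 1 then (φ q - φ p) ^ 2 else 0)) ≤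
      2 * (6 * M * Dev + 3 * M ^ 2 * D d) := by
    intro d
    have e1 := sum_sq_pairs_le (C := fun p : {v // v ∈ Γ} => C p) hM φ g ((d + 1) • 1)
    simp only [Finset.sum_add_distrib]
    rw [Finset.sum_comm (f := fun p q : {v // v ∈ Γ} =>
      if C p = C q + (d + 1) • 1 then (φ q - φ p) ^ 2 else 0)]
    linarith
  clear_value Dev D
  calc boundaryForm G Γ φ ≤ _ := Finset.sum_le_sum fun p _ => Finset.sum_le_sum fun q _ => hpt p q
    _ = ∑ p : {v // v ∈ Γ}, ∑ q : {v // v ∈ Γ},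
          (if C q = C p + 0 then (φ p - φ q) ^ 2 else 0) +
        ∑ d ∈ Finset.range N, (∑ p : {v // v ∈ Γ}, ∑ q : {v // v ∈ Γ},
          ((if C q = C p + (d + 1) • 1 then (φ p - φ q) ^ 2 else 0) +
          (if C p = C q + (d + 1) • 1 then (φ q - φ p) ^ 2 else 0))) *
            (1 / ((d : ℝ) + 1) ^ 2) := by
        simp only [Finset.sum_mul]
        rw [Finset.sum_comm (s := Finset.range N)]
        simp only [Finset.sum_comm (s := Finset.range N)]
        simp only [← Finset.sum_add_distrib]
    _ ≤ 6 * M * Dev + ∑ d ∈ Finset.range N,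
        (2 * (6 * M * Dev + 3 * M ^ 2 * D d)) * (1 / ((d : ℝ) + 1) ^ 2) := by
        refine add_le_add h0 (Finset.sum_le_sum fun d _ => ?_)
        exact mul_le_mul_of_nonneg_right (hd d) (by positivity)
    _ = 6 * M * Dev + 12 * M * Dev * ∑ d ∈ Finset.range N, 1 / ((d : ℝ) + 1) ^ 2 +
        6 * M ^ 2 * ∑ d ∈ Finset.range N, D d / ((d : ℝ) + 1) ^ 2 := by
        rw [add_assoc, Finset.mul_sum, Finset.mul_sum, ← Finset.sum_add_distrib]
        congr 1
        exact Finset.sum_congr rfl fun d _ => by ring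
    -- As the inverse squares sum to at most 2, the coefficient of `Dev` is `6 + 12 * 2 = 30` times
    -- `M`.
    _ ≤ _ := by
        have := mul_le_mul_of_nonneg_left (sum_inv_sq_le_two N)
          (show (0 : ℝ) ≤ 12 * M * Dev by positivity)
        simp only [hD]
        linarith

/-- The trace inequality for aggregated graphs. -/
theorem boundaryForm_le_dirichlet [Fintype V] [DecidableRel G.Adj]
    (hP : IsAggregationPartition G Γ M H a aStar) (hgrid : grid (n + 2) (m + 2) ≤ H)
    (hstar : H ≤ gridStar (n + 2) (m + 2)) (hC : ∀ v ∈ Γ, v ∈ a (C v, 0))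
    (hΓ : (G.induce {v | v ∈ Γ}).Preconnected) {c : ℕ} (hc : n + 2 < 2 * c * (m + 2)) {X : ℝ}
    (hcX : 3 * (c : ℝ) ≤ X) (hX : 36 ≤ X) (u : V → ℝ) :
    boundaryForm G Γ (fun p => u p) ≤ 36 * M ^ 3 * X * dirichlet G u := by
  have hM1 := hP.one_le_bound
  have hM : (1 : ℝ) ≤ M := by exact_mod_cast hM1
  have hne : ∀ x, ∃ v, v ∈ a x := fun x => by
    obtain ⟨⟨v, hv⟩⟩ := (hP.connected x).nonempty
    exact ⟨v, hv⟩
  choose r hr using hne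
  have hE := dirichlet_nonneg G u
  set E := dirichlet G u with hE_def
  -- The value 0 beyond the last row is never read: `cylinder_trace` with `L = m + 1` involves only
  -- rows up to `m + 1`.
  let U : Fin (n + 2) → ℕ → ℝ := fun i j => if h : j < m + 2 then u (r (i, ⟨j, h⟩)) else 0
  have hU : ∀ i (j : Fin (m + 2)), U i j = u (r (i, j)) := fun i j => by simp [U]
  have hU0 : ∀ i, U i 0 = u (r (i, 0)) := fun i => hU i 0
  have hhor : ∑ j ∈ Finset.range (m + 1 + 1), ∑ i, (U (i + 1) j - U i j) ^ 2 ≤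
      3 / 2 * (2 * M - 1) * E := by
    have h := sum_sq_representatives_le (G := G) hP.disjoint hP.connected hM1 hP.card_le u hr
      (ι := Fin (m + 2) × Fin (n + 2)) (x := fun q => (q.2 + 1, q.1)) (y := fun q => (q.2, q.1))
      (fun q q' h => by
        simp only [Prod.mk.injEq, add_left_inj] at h
        exact Prod.ext h.2 h.1)
      (fun q q' h => by
        simp only [Prod.mk.injEq] at h
        exact Prod.ext h.2 h.1)
      (fun q => by simp)
      (fun q => (hP.adj_iff _ _ (by simp)).1 (hgrid (by
        simp [grid, SimpleGraph.boxProd_adj, SimpleGraph.cycleGraph_adj])))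
    rw [Fintype.sum_prod_type] at h
    rw [Finset.sum_range]
    simpa only [hU] using h
  have hver : ∑ j ∈ Finset.range (m + 1), ∑ i, (U i (j + 1) - U i j) ^ 2 ≤
      3 / 2 * (2 * M - 1) * E := by
    have h := sum_sq_representatives_le (G := G) hP.disjoint hP.connected hM1 hP.card_le u hr
      (ι := Fin (m + 1) × Fin (n + 2)) (x := fun q => (q.2, q.1.succ))
      (y := fun q => (q.2, q.1.castSucc))
      (fun q q' h => by
        simp only [Prod.mk.injEq, Fin.succ_inj] at h
        exact Prod.ext h.2 h.1)
      (fun q q' h => by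
        simp only [Prod.mk.injEq, Fin.castSucc_inj] at h
        exact Prod.ext h.2 h.1)
      (fun q => by simp [Fin.ext_iff])
      (fun q => (hP.adj_iff _ _ (by simp [Fin.ext_iff])).1 (hgrid (by
        simp [grid, SimpleGraph.boxProd_adj, SimpleGraph.pathGraph_adj])))
    rw [Fintype.sum_prod_type] at h
    rw [Finset.sum_range]
    refine le_trans (le_of_eq ?_) h
    refine Finset.sum_congr rfl fun j _ => Finset.sum_congr rfl fun i _ => ?_
    rw [← hU i j.succ, ← hU i j.castSucc]
    rfl
  have hDev : ∑ p : {v // v ∈ Γ}, (u p - U (C p) 0) ^ 2 ≤ M ^ 2 / 2 * E := by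
    have h1 : ∀ p : {v // v ∈ Γ}, (u p - U (C p) 0) ^ 2 ≤
        ((M : ℝ) - 1) / 2 * blockForm G u (a (C p, 0)) (a (C p, 0)) := by
      intro p
      have := two_mul_sq_sub_le_blockForm (hP.connected (C p, 0)) (hP.card_le _) u (hC p p.2)
        (hr (C p, 0))
      rw [hU0]
      linarith
    have h2 := sum_comp_le_mul_sum (C := fun p : {v // v ∈ Γ} => C p) (hP.card_column_le hC)
      (fun i => ((M : ℝ) - 1) / 2 * blockForm G u (a (i, 0)) (a (i, 0)))
      (fun i => mul_nonneg (by linarith) (blockForm_nonneg u _ _))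
    have h3 : ∑ i, blockForm G u (a (i, 0)) (a (i, 0)) ≤ E := by
      refine (sum_comp_le_of_injective (x := fun i : Fin (n + 2) => (i, (0 : Fin (m + 2))))
        (fun i j h => congrArg Prod.fst h) (fun z => blockForm G u (a z) (a z))
        fun z => blockForm_nonneg u _ _).trans ?_
      exact (Finset.sum_le_sum fun z _ => Finset.single_le_sum
        (f := fun z' => blockForm G u (a z) (a z')) (fun z' _ => blockForm_nonneg u _ _)
        (Finset.mem_univ z)).trans (sum_blockForm_le hP.disjoint u)
    refine ((Finset.sum_le_sum fun p _ => h1 p).trans h2).trans ?_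
    rw [← Finset.mul_sum]
    have h4 := mul_le_mul_of_nonneg_left h3
      (show (0 : ℝ) ≤ M * (((M : ℝ) - 1) / 2) from mul_nonneg (by linarith) (by linarith))
    nlinarith
  have h1 := hP.boundaryForm_le_columns hstar hC hΓ (N := c * (m + 2))
    (by rw [← mul_assoc]; exact hc) (fun p => u p) (fun i => U i 0)
  have h2 := cylinder_trace U (1 : Fin (n + 2)) c (m + 1)
  have h3 := mul_le_mul hcX hhor (Finset.sum_nonneg fun _ _ => Finset.sum_nonneg
    fun _ _ => sq_nonneg _) (by linarith)
  have h4 : ∑ d ∈ Finset.range (c * (m + 2)),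
      (∑ i, (U (i + (d + 1) • 1) 0 - U i 0) ^ 2) / ((d : ℝ) + 1) ^ 2 ≤
      3 * M * X * E + 72 * M * E := by
    have hME : 0 ≤ X * E := mul_nonneg (by linarith) hE
    nlinarith
  have h5 := mul_le_mul_of_nonneg_left h4 (show (0 : ℝ) ≤ 6 * M ^ 2 by positivity)
  have h6 := mul_le_mul_of_nonneg_left hDev (show (0 : ℝ) ≤ 30 * M by positivity)
  have h7 : (0 : ℝ) ≤ M ^ 3 * E := by positivity
  have h8 := mul_le_mul_of_nonneg_right hX h7
  calc _ ≤ 30 * M * (M ^ 2 / 2 * E) + 6 * M ^ 2 * (3 * M * X * E + 72 * M * E) := by linarith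
    -- The terms free of `X` total `15 + 432 = 447`, at most `18 * 36`, hence absorbed by `18 * X`;
    -- the horizontal term gives the other `18 * X`.
    _ ≤ _ := by nlinarith

end IsAggregationPartition

/-! ### The cost of the diagonal edges -/

section GridForm

variable {n m : ℕ}

lemma sum_fin_succ_pairs (T : ℕ → ℕ → ℝ) :
    ∑ j : Fin (m + 2), ∑ j' : Fin (m + 2), (if (j' : ℕ) = j + 1 then T j j' else 0) =
      ∑ j ∈ Finset.range (m + 1), T j (j + 1) := by
  rw [Fin.sum_univ_castSucc, Finset.sum_range]
  have h0 : ∑ j' : Fin (m + 2), (if (j' : ℕ) = (Fin.last (m + 1) : Fin (m + 2)) + 1 then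
      T (Fin.last (m + 1) : Fin (m + 2)) j' else 0) = 0 :=
    Finset.sum_eq_zero fun j' _ => if_neg (by
      have := j'.2
      rw [Fin.val_last]; omega)
  rw [h0, add_zero]
  refine Finset.sum_congr rfl fun j _ => ?_
  rw [Finset.sum_eq_single j.succ]
  · simp
  · intro j' _ hj'
    refine if_neg fun h => hj' (Fin.ext ?_)
    simpa using h
  · simp

lemma sum_shifted_rows (W : Fin (n + 2) → ℕ → ℝ) (δ : Fin (n + 2)) :
    ∑ x : Fin (n + 2) × Fin (m + 2), ∑ y : Fin (n + 2) × Fin (m + 2),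
      (if (y.2 : ℕ) = x.2 + 1 ∧ y.1 = x.1 + δ then (W x.1 x.2 - W y.1 y.2) ^ 2 else 0) =
    ∑ j ∈ Finset.range (m + 1), ∑ i, (W (i + δ) (j + 1) - W i j) ^ 2 := by
  rw [Finset.sum_comm (s := Finset.range (m + 1)), Fintype.sum_prod_type]
  refine Finset.sum_congr rfl fun i _ => ?_
  rw [← sum_fin_succ_pairs (fun j j' => (W (i + δ) j' - W i j) ^ 2)]
  refine Finset.sum_congr rfl fun j _ => ?_
  rw [Fintype.sum_prod_type, Finset.sum_comm]
  refine Finset.sum_congr rfl fun j' _ => ?_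
  rw [Finset.sum_eq_single (i + δ)]
  · simp only [and_true]
    split_ifs
    · ring
    · rfl
  · intro i' _ hi'
    exact if_neg fun h => hi' h.2
  · simp

open Classical in
/-- The energy on the cylinder with diagonals is controlled by the one without them. -/
lemma gridStar_form_le (W : Fin (n + 2) → ℕ → ℝ) :
    ∑ x : Fin (n + 2) × Fin (m + 2), ∑ y : Fin (n + 2) × Fin (m + 2),
      (if (gridStar (n + 2) (m + 2)).Adj x y then (W x.1 x.2 - W y.1 y.2) ^ 2 else 0) ≤
    10 * (∑ j ∈ Finset.range (m + 1 + 1), ∑ i, (W (i + 1) j - W i j) ^ 2 +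
      ∑ j ∈ Finset.range (m + 1), ∑ i, (W i (j + 1) - W i j) ^ 2) := by
  set Eh := ∑ j ∈ Finset.range (m + 1 + 1), ∑ i, (W (i + 1) j - W i j) ^ 2 with hEh
  set Ev := ∑ j ∈ Finset.range (m + 1), ∑ i, (W i (j + 1) - W i j) ^ 2 with hEv
  -- One orientation of every edge: horizontal, vertical, two diagonals. Each diagonal family costs
  -- `2 * Eh + 2 * Ev`, so the sum is at most `5 * (Eh + Ev)`; both orientations give 10.
  let F : Fin (n + 2) × Fin (m + 2) → Fin (n + 2) × Fin (m + 2) → ℝ := fun x y =>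
    (if y = (x.1 + 1, x.2) then (W x.1 x.2 - W y.1 y.2) ^ 2 else 0) +
    (if (y.2 : ℕ) = x.2 + 1 ∧ y.1 = x.1 + 0 then (W x.1 x.2 - W y.1 y.2) ^ 2 else 0) +
    (if (y.2 : ℕ) = x.2 + 1 ∧ y.1 = x.1 + 1 then (W x.1 x.2 - W y.1 y.2) ^ 2 else 0) +
    (if (y.2 : ℕ) = x.2 + 1 ∧ y.1 = x.1 + -1 then (W x.1 x.2 - W y.1 y.2) ^ 2 else 0)
  have hite : ∀ (p : Prop) [Decidable p] (z : ℝ), 0 ≤ (if p then z ^ 2 else 0) := by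
    intro p _ z
    split_ifs <;> positivity
  have hF0 : ∀ x y, 0 ≤ F x y := fun x y =>
    add_nonneg (add_nonneg (add_nonneg (hite _ _) (hite _ _)) (hite _ _)) (hite _ _)
  have hF : ∀ x y : Fin (n + 2) × Fin (m + 2), (y = (x.1 + 1, x.2) ∨ ((y.2 : ℕ) = x.2 + 1 ∧
      (y.1 = x.1 + 0 ∨ y.1 = x.1 + 1 ∨ y.1 = x.1 + -1))) →
      (W x.1 x.2 - W y.1 y.2) ^ 2 ≤ F x y := by
    intro x y h
    have k1 := hite (y = (x.1 + 1, x.2)) (W x.1 x.2 - W y.1 y.2)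
    have k2 := hite ((y.2 : ℕ) = x.2 + 1 ∧ y.1 = x.1 + 0) (W x.1 x.2 - W y.1 y.2)
    have k3 := hite ((y.2 : ℕ) = x.2 + 1 ∧ y.1 = x.1 + 1) (W x.1 x.2 - W y.1 y.2)
    have k4 := hite ((y.2 : ℕ) = x.2 + 1 ∧ y.1 = x.1 + -1) (W x.1 x.2 - W y.1 y.2)
    simp only [F]
    rcases h with h | ⟨h, h' | h' | h'⟩
    · rw [if_pos h] at k1 ⊢; linarith
    · rw [if_pos (And.intro h h')] at k2 ⊢; linarith
    · rw [if_pos (And.intro h h')] at k3 ⊢; linarith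
    · rw [if_pos (And.intro h h')] at k4 ⊢; linarith
  have hpt : ∀ x y, (if (gridStar (n + 2) (m + 2)).Adj x y then (W x.1 x.2 - W y.1 y.2) ^ 2
      else 0) ≤ F x y + F y x := by
    intro x y
    split_ifs with h
    · have h1 := hF x y
      have h2 := hF y x
      rw [show (W y.1 y.2 - W x.1 x.2) ^ 2 = (W x.1 x.2 - W y.1 y.2) ^ 2 by ring] at h2
      suffices hc : (y = (x.1 + 1, x.2) ∨ ((y.2 : ℕ) = x.2 + 1 ∧
          (y.1 = x.1 + 0 ∨ y.1 = x.1 + 1 ∨ y.1 = x.1 + -1))) ∨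
          (x = (y.1 + 1, y.2) ∨ ((x.2 : ℕ) = y.2 + 1 ∧
          (x.1 = y.1 + 0 ∨ x.1 = y.1 + 1 ∨ x.1 = y.1 + -1))) by
        rcases hc with hc | hc
        · linarith [h1 hc, hF0 y x]
        · linarith [h2 hc, hF0 x y]
      obtain ⟨i, j⟩ := x
      obtain ⟨i', j'⟩ := y
      simp only [gridStar, grid, SimpleGraph.boxProd_adj, SimpleGraph.cycleGraph_adj,
        SimpleGraph.pathGraph_adj] at h
      simp only [Prod.mk.injEq, add_zero]
      have e1 : i - i' = 1 → i = i' + 1 ∧ i' = i + -1 := fun h => by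
        constructor <;> rw [← h] <;> abel
      have e2 : i' - i = 1 → i' = i + 1 ∧ i = i' + -1 := fun h => by
        constructor <;> rw [← h] <;> abel
      rcases h with (⟨h | h, h'⟩ | ⟨h | h, h'⟩) | ⟨h | h, h' | h'⟩
      · exact Or.inr (Or.inl ⟨(e1 h).1, h'⟩)
      · exact Or.inl (Or.inl ⟨(e2 h).1, h'.symm⟩)
      · exact Or.inl (Or.inr ⟨h.symm, Or.inl h'.symm⟩)
      · exact Or.inr (Or.inr ⟨h.symm, Or.inl h'⟩)
      · exact Or.inl (Or.inr ⟨h'.symm, Or.inr (Or.inr (e1 h).2)⟩)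
      · exact Or.inr (Or.inr ⟨h'.symm, Or.inr (Or.inl (e1 h).1)⟩)
      · exact Or.inl (Or.inr ⟨h'.symm, Or.inr (Or.inl (e2 h).1)⟩)
      · exact Or.inr (Or.inr ⟨h'.symm, Or.inr (Or.inr (e2 h).2)⟩)
    · exact add_nonneg (hF0 _ _) (hF0 _ _)
  have hrow : ∑ j ∈ Finset.range (m + 1), ∑ i, (W (i + 1) (j + 1) - W i (j + 1)) ^ 2 ≤ Eh := by
    rw [hEh, Finset.sum_range_succ' _ (m + 1)]
    exact le_add_of_nonneg_right (Finset.sum_nonneg fun _ _ => sq_nonneg _)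
  have hdiag : ∀ δ : Fin (n + 2), (∀ j, ∑ i, (W (i + δ) j - W i j) ^ 2 =
      ∑ i, (W (i + 1) j - W i j) ^ 2) →
      ∑ j ∈ Finset.range (m + 1), ∑ i, (W (i + δ) (j + 1) - W i j) ^ 2 ≤ 2 * Eh + 2 * Ev := by
    intro δ hδ
    calc _ ≤ ∑ j ∈ Finset.range (m + 1), ∑ i, (2 * (W (i + δ) (j + 1) - W i (j + 1)) ^ 2 +
          2 * (W i (j + 1) - W i j) ^ 2) := by
          refine Finset.sum_le_sum fun j _ => Finset.sum_le_sum fun i _ => ?_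
          nlinarith [sq_nonneg (W (i + δ) (j + 1) - W i (j + 1) - (W i (j + 1) - W i j))]
      _ = 2 * ∑ j ∈ Finset.range (m + 1), ∑ i, (W (i + 1) (j + 1) - W i (j + 1)) ^ 2 +
          2 * Ev := by
          simp only [Finset.sum_add_distrib, ← Finset.mul_sum, hδ, hEv]
      _ ≤ _ := by linarith
  have hneg : ∀ j, ∑ i, (W (i + -1) j - W i j) ^ 2 = ∑ i, (W (i + 1) j - W i j) ^ 2 := by
    intro j
    rw [← sum_shift (fun i => (W (i + -1) j - W i j) ^ 2) 1]
    refine Finset.sum_congr rfl fun i _ => ?_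
    rw [add_neg_cancel_right]; ring
  have hhor : ∑ x : Fin (n + 2) × Fin (m + 2), ∑ y : Fin (n + 2) × Fin (m + 2),
      (if y = (x.1 + 1, x.2) then (W x.1 x.2 - W y.1 y.2) ^ 2 else 0) = Eh := by
    simp only [Finset.sum_ite_eq', Finset.mem_univ, if_true]
    rw [Fintype.sum_prod_type, hEh, Finset.sum_range, Finset.sum_comm]
    exact Finset.sum_congr rfl fun j _ => Finset.sum_congr rfl fun i _ => by ring
  have hFsum : ∑ x, ∑ y, F x y ≤ 5 * (Eh + Ev) := by
    simp only [F, Finset.sum_add_distrib]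
    rw [hhor, sum_shifted_rows, sum_shifted_rows, sum_shifted_rows]
    have h1 := hdiag 1 fun j => rfl
    have h2 := hdiag (-1) hneg
    simp only [add_zero]
    linarith
  have hcomm : ∑ x, ∑ y, F y x = ∑ x, ∑ y, F x y := Finset.sum_comm
  calc _ ≤ ∑ x, ∑ y, (F x y + F y x) :=
        Finset.sum_le_sum fun x _ => Finset.sum_le_sum fun y _ => hpt x y
    _ = 2 * ∑ x, ∑ y, F x y := by
        simp only [Finset.sum_add_distrib]
        rw [hcomm]; ring
    _ ≤ _ := by linarith

end GridForm

/-! ### Pullback of cylinder functions and the extension theorem -/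

section Pullback

variable {V : Type*} [Fintype V] {G : SimpleGraph V} [DecidableRel G.Adj]

lemma dirichlet_add_le (f g : V → ℝ) :
    dirichlet G (fun v => f v + g v) ≤ 2 * dirichlet G f + 2 * dirichlet G g := by
  simp only [dirichlet, Finset.mul_sum, ← Finset.sum_add_distrib]
  refine Finset.sum_le_sum fun v _ => Finset.sum_le_sum fun w _ => ?_
  split_ifs
  · nlinarith [sq_nonneg (f v - f w - (g v - g w))]
  · simp

lemma dirichlet_le_degree (g : V → ℝ) : dirichlet G g ≤ 4 * ∑ v, G.degree v * g v ^ 2 := by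
  have h1 : ∀ v, ∑ w, (if G.Adj v w then g v ^ 2 else 0) = G.degree v * g v ^ 2 := by
    intro v
    rw [← Finset.sum_filter, Finset.sum_const, nsmul_eq_mul,
      ← SimpleGraph.card_neighborFinset_eq_degree, SimpleGraph.neighborFinset_eq_filter]
  have h2 : ∑ v, ∑ w, (if G.Adj v w then g w ^ 2 else 0) =
      ∑ v, ∑ w, (if G.Adj v w then g v ^ 2 else 0) := by
    rw [Finset.sum_comm]
    simp only [G.adj_comm]
  calc _ ≤ ∑ v, ∑ w, (2 * (if G.Adj v w then g v ^ 2 else 0) +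
        2 * (if G.Adj v w then g w ^ 2 else 0)) := by
        refine Finset.sum_le_sum fun v _ => Finset.sum_le_sum fun w _ => ?_
        split_ifs
        · nlinarith [sq_nonneg (g v + g w)]
        · simp
    _ = _ := by
        simp only [Finset.sum_add_distrib, ← Finset.mul_sum]
        rw [h2]
        simp only [h1]
        ring

end Pullback

namespace IsAggregationPartition

variable {V : Type*} {G : SimpleGraph V} {Γ : Finset V} {M n m : ℕ}
  {H : SimpleGraph (Fin (n + 2) × Fin (m + 2))} {a : Fin (n + 2) × Fin (m + 2) → Finset V}
  {aStar : Finset V} {C : V → Fin (n + 2)}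

open Classical in
/-- The function equal to `W i j` on the set with index `(i, j)` and to `x` on the remaining
vertices. -/
noncomputable def pullback (a : Fin (n + 2) × Fin (m + 2) → Finset V) (W : Fin (n + 2) → ℕ → ℝ)
    (x : ℝ) (v : V) : ℝ :=
  if h : ∃ y, v ∈ a y then W h.choose.1 h.choose.2 else x

lemma pullback_of_mem (hP : IsAggregationPartition G Γ M H a aStar) (W : Fin (n + 2) → ℕ → ℝ)
    (x : ℝ) {v : V} {y : Fin (n + 2) × Fin (m + 2)} (hv : v ∈ a y) :
    pullback a W x v = W y.1 y.2 := by
  have h : ∃ y, v ∈ a y := ⟨y, hv⟩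
  rw [pullback, dif_pos h, hP.eq_of_mem h.choose_spec hv]

lemma pullback_of_mem_star (hP : IsAggregationPartition G Γ M H a aStar)
    (W : Fin (n + 2) → ℕ → ℝ) (x : ℝ) {v : V} (hv : v ∈ aStar) : pullback a W x v = x := by
  rw [pullback, dif_neg]
  rintro ⟨y, hy⟩
  exact Finset.disjoint_left.1 (hP.disjoint_star y) hy hv

open Classical in
-- Only edges between distinct cells contribute, at most `M ^ 2` for each ordered pair. Edges at
-- `aStar` cost nothing because `aStar` touches only the last row, where `W` is already `x`.
lemma dirichlet_pullback_le [Fintype V] [DecidableRel G.Adj]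
    (hP : IsAggregationPartition G Γ M H a aStar) (hstar : H ≤ gridStar (n + 2) (m + 2))
    (W : Fin (n + 2) → ℕ → ℝ) (x : ℝ) (hW : ∀ i, W i (m + 1) = x) :
    dirichlet G (pullback a W x) ≤ M ^ 2 *
      ∑ y : Fin (n + 2) × Fin (m + 2), ∑ z : Fin (n + 2) × Fin (m + 2),
        (if (gridStar (n + 2) (m + 2)).Adj y z then (W y.1 y.2 - W z.1 z.2) ^ 2 else 0) := by
  set f := pullback a W x with hf
  let K : Fin (n + 2) × Fin (m + 2) → Fin (n + 2) × Fin (m + 2) → ℝ := fun y z =>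
    if (gridStar (n + 2) (m + 2)).Adj y z then (W y.1 y.2 - W z.1 z.2) ^ 2 else 0
  have hK0 : ∀ y z, 0 ≤ K y z := fun y z => by simp only [K]; split_ifs <;> positivity
  have hT0 : ∀ v w y z, 0 ≤ (if v ∈ a y then (if w ∈ a z then K y z else 0) else 0) :=
    fun v w y z => by split_ifs <;> first | exact hK0 y z | exact le_rfl
  have hlast : ∀ v w, G.Adj v w → v ∈ aStar → f w = x := by
    intro v w hvw hv
    rcases hP.star_neighbors v hv w hvw with h | ⟨i, j, hj, h⟩
    · exact hP.pullback_of_mem_star W x h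
    · rw [hf, hP.pullback_of_mem W x h]
      simp only
      rw [show (j : ℕ) = m + 1 by omega, hW]
  have hpt : ∀ v w, (if G.Adj v w then (f v - f w) ^ 2 else 0) ≤
      ∑ y, ∑ z, (if v ∈ a y then (if w ∈ a z then K y z else 0) else 0) := by
    intro v w
    have hnn : 0 ≤ ∑ y, ∑ z, (if v ∈ a y then (if w ∈ a z then K y z else 0) else 0) :=
      Finset.sum_nonneg fun y _ => Finset.sum_nonneg fun z _ => hT0 v w y z
    split_ifs with hvw
    · by_cases hv : v ∈ aStar
      · rw [hlast v w hvw hv, hf, hP.pullback_of_mem_star W x hv]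
        simpa using hnn
      by_cases hw : w ∈ aStar
      · rw [hlast w v hvw.symm hw, hf, hP.pullback_of_mem_star W x hw]
        simpa using hnn
      obtain ⟨y, hy⟩ := (hP.cover v).resolve_left hv
      obtain ⟨z, hz⟩ := (hP.cover w).resolve_left hw
      by_cases hyz : y = z
      · rw [hf, hP.pullback_of_mem W x hy, hP.pullback_of_mem W x hz, hyz]
        simpa using hnn
      have hadj : (gridStar (n + 2) (m + 2)).Adj y z :=
        hstar ((hP.adj_iff y z hyz).2 ⟨v, hy, w, hz, hvw⟩)
      have h1 := Finset.single_le_sum (f := fun z =>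
        if v ∈ a y then (if w ∈ a z then K y z else 0) else 0)
        (fun z _ => hT0 v w y z) (Finset.mem_univ z)
      have h2 := Finset.single_le_sum (f := fun y => ∑ z,
        if v ∈ a y then (if w ∈ a z then K y z else 0) else 0)
        (fun y _ => Finset.sum_nonneg fun z _ => hT0 v w y z) (Finset.mem_univ y)
      refine le_trans (le_of_eq ?_) (h1.trans h2)
      rw [if_pos hy, if_pos hz, hf, hP.pullback_of_mem W x hy, hP.pullback_of_mem W x hz]
      exact (if_pos hadj).symm
    · exact hnn
  calc dirichlet G f ≤ ∑ v, ∑ w, ∑ y, ∑ z,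
        (if v ∈ a y then (if w ∈ a z then K y z else 0) else 0) :=
        Finset.sum_le_sum fun v _ => Finset.sum_le_sum fun w _ => hpt v w
    _ = ∑ y, ∑ z, ∑ v, ∑ w, (if v ∈ a y then (if w ∈ a z then K y z else 0) else 0) := by
        rw [Finset.sum_congr rfl fun v _ => Finset.sum_comm, Finset.sum_comm]
        refine Finset.sum_congr rfl fun y _ => ?_
        rw [Finset.sum_congr rfl fun v _ => Finset.sum_comm, Finset.sum_comm]
    _ = ∑ y, ∑ z, (a y).card * ((a z).card * K y z) := by
        refine Finset.sum_congr rfl fun y _ => Finset.sum_congr rfl fun z _ => ?_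
        have h1 : ∀ v, ∑ w, (if v ∈ a y then (if w ∈ a z then K y z else 0) else 0) =
            if v ∈ a y then (a z).card * K y z else 0 := by
          intro v
          split_ifs
          · simp
          · simp
        simp only [h1]
        simp
    _ ≤ ∑ y, ∑ z, M ^ 2 * K y z := by
        refine Finset.sum_le_sum fun y _ => Finset.sum_le_sum fun z _ => ?_
        rw [← mul_assoc, sq]
        refine mul_le_mul_of_nonneg_right ?_ (hK0 y z)
        exact mul_le_mul (by exact_mod_cast hP.card_le y) (by exact_mod_cast hP.card_le z)
          (Nat.cast_nonneg _) (Nat.cast_nonneg _)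
    _ = _ := by simp only [Finset.mul_sum, K]

/-- With at least two rows, a first-row cell does not touch `aStar`; neighbours lie in three columns
and two rows, that is, in at most six cells. -/
lemma degree_le [Fintype V] [DecidableRel G.Adj]
    (hP : IsAggregationPartition G Γ M H a aStar) (hstar : H ≤ gridStar (n + 2) (m + 2))
    {v : V} {i : Fin (n + 2)} (hv : v ∈ a (i, 0)) : G.degree v ≤ 6 * M := by
  classical
  let Y : Finset (Fin (n + 2) × Fin (m + 2)) := {i, i + 1, i + -1} ×ˢ {0, 1}
  have hY : Y.card ≤ 6 := by
    rw [Finset.card_product]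
    exact Nat.mul_le_mul Finset.card_le_three Finset.card_le_two
  have hsub : G.neighborFinset v ⊆ Y.biUnion a := by
    intro w hw
    have hvw : G.Adj v w := (SimpleGraph.mem_neighborFinset _ _ _).1 hw
    rcases hP.cover w with h | ⟨⟨i', j'⟩, h⟩
    · exfalso
      rcases hP.star_neighbors w h v hvw.symm with h' | ⟨i', j', hj, h'⟩
      · exact Finset.disjoint_left.1 (hP.disjoint_star _) hv h'
      · have := congrArg Prod.snd (hP.eq_of_mem hv h')
        simp only at this
        rw [← this] at hj
        simp at hj
    · refine Finset.mem_biUnion.2 ⟨_, ?_, h⟩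
      by_cases he : ((i, 0) : Fin (n + 2) × Fin (m + 2)) = (i', j')
      · rw [← he]; simp [Y]
      have hadj := hstar ((hP.adj_iff _ _ he).2 ⟨v, hv, w, h, hvw⟩)
      simp only [gridStar, grid, SimpleGraph.boxProd_adj, SimpleGraph.cycleGraph_adj,
        SimpleGraph.pathGraph_adj] at hadj
      have e1 : i - i' = 1 → i' = i + -1 := fun h => by rw [← h]; abel
      have e2 : i' - i = 1 → i' = i + 1 := fun h => by rw [← h]; abel
      have e3 : ((0 : Fin (m + 2)) : ℕ) + 1 = j' ∨ (j' : ℕ) + 1 = (0 : Fin (m + 2)) → j' = 1 := by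
        rintro (h | h)
        · exact Fin.ext (by rw [← h]; rfl)
        · simp at h
      simp only [Y, Finset.mem_product, Finset.mem_insert, Finset.mem_singleton]
      rcases hadj with (⟨h | h, h'⟩ | ⟨h', h⟩) | ⟨h | h, h'⟩
      · exact ⟨Or.inr (Or.inr (e1 h)), Or.inl h'.symm⟩
      · exact ⟨Or.inr (Or.inl (e2 h)), Or.inl h'.symm⟩
      · exact ⟨Or.inl h.symm, Or.inr (e3 h')⟩
      · exact ⟨Or.inr (Or.inr (e1 h)), Or.inr (e3 h')⟩
      · exact ⟨Or.inr (Or.inl (e2 h)), Or.inr (e3 h')⟩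
  rw [← SimpleGraph.card_neighborFinset_eq_degree]
  calc _ ≤ _ := Finset.card_le_card hsub
    _ ≤ Y.card * M := Finset.card_biUnion_le_card_mul _ _ _ fun y _ => hP.card_le y
    _ ≤ _ := Nat.mul_le_mul_right M hY

/-- The extension theorem for aggregated graphs. -/
theorem exists_extension [Fintype V] [DecidableRel G.Adj]
    (hP : IsAggregationPartition G Γ M H a aStar) (hstar : H ≤ gridStar (n + 2) (m + 2))
    (hC : ∀ v ∈ Γ, v ∈ a (C v, 0)) (hΓ : (G.induce {v | v ∈ Γ}).Preconnected)
    (hdist : ∀ (p q : {v // v ∈ Γ}) (t : ℕ), C q = C p + t • 1 →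
      (G.induce {v | v ∈ Γ}).dist p q < M * (t + 1))
    (hmn : m < n) {c : ℕ} (hc : n + 2 < 2 * c * (m + 2)) (φ : {v // v ∈ Γ} → ℝ) :
    ∃ u : V → ℝ, (∀ p : {v // v ∈ Γ}, u p = φ p) ∧
      dirichlet G u ≤ (160 * c + 208) * M ^ 4 * boundaryForm G Γ φ := by
  classical
  have hM1 : (1 : ℝ) ≤ M := by exact_mod_cast hP.one_le_bound
  have hQ0 := boundaryForm_nonneg G Γ φ
  set Q := boundaryForm G Γ φ with hQ
  let τ : {v // v ∈ Γ} × {v // v ∈ Γ} → ℝ := fun x =>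
    ((((G.induce {v | v ∈ Γ}).dist x.1 x.2 : ℕ) : ℝ) ^ 2)⁻¹ * (φ x.1 - φ x.2) ^ 2
  have hτ0 : ∀ x, 0 ≤ τ x := fun x => by simp only [τ]; positivity
  have hτsum : ∑ x, τ x = Q := by rw [Fintype.sum_prod_type]; rfl
  have hτ : ∀ p q : {v // v ∈ Γ}, ∀ K : ℕ, (G.induce {v | v ∈ Γ}).dist p q ≤ K →
      (φ p - φ q) ^ 2 ≤ K ^ 2 * τ (p, q) := by
    intro p q K hK
    rcases Nat.eq_zero_or_pos ((G.induce {v | v ∈ Γ}).dist p q) with h | h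
    · have hpq : p = q := (hΓ p q).dist_eq_zero_iff.1 h
      rw [hpq, sub_self, zero_pow two_ne_zero]
      exact mul_nonneg (sq_nonneg _) (hτ0 _)
    · have h1 : (0 : ℝ) < (G.induce {v | v ∈ Γ}).dist p q := by exact_mod_cast h
      have h2 : (((G.induce {v | v ∈ Γ}).dist p q : ℕ) : ℝ) ^ 2 * τ (p, q) = (φ p - φ q) ^ 2 := by
        simp only [τ]; field_simp
      rw [← h2]
      refine mul_le_mul_of_nonneg_right ?_ (hτ0 _)
      gcongr
  have hrep : ∀ i, ∃ p : {v // v ∈ Γ}, C p = i := fun i => by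
    obtain ⟨v, hv, hvi⟩ := hP.boundary_meets i 0 rfl
    exact ⟨⟨v, hv⟩, congrArg Prod.fst (hP.eq_of_mem (hC v hv) hvi)⟩
  choose r hr using hrep
  have hrinj : Function.Injective r := fun i j h => by rw [← hr i, h, hr j]
  let ψ : Fin (n + 2) → ℝ := fun i => φ (r i)
  let k : ℝ := (n : ℝ) + 2
  have hk : 0 < k := by simp only [k]; positivity
  let x : ℝ := (∑ i, ψ i) / k
  let S := ∑ t ∈ Finset.range (m + 1 + 1),
    (∑ i, (ψ (i + (t + 1) • 1) - ψ i) ^ 2) / ((t : ℝ) + 1) ^ 2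
  have hS : S ≤ 4 * M ^ 2 * Q := by
    have h1 : ∀ (t : ℕ) i, (ψ (i + (t + 1) • 1) - ψ i) ^ 2 / ((t : ℝ) + 1) ^ 2 ≤
        4 * M ^ 2 * τ (r i, r (i + (t + 1) • 1)) := by
      intro t i
      -- The distance is below `M * (t + 2)`, hence at most `2 * M * (t + 1)`; this is the source of
      -- `4 * M ^ 2`.
      have hd := hdist (r i) (r (i + (t + 1) • 1)) (t + 1) (by rw [hr, hr])
      have := hτ (r i) (r (i + (t + 1) • 1)) (2 * M * (t + 1)) (by nlinarith)
      rw [div_le_iff₀ (by positivity)]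
      push_cast at this
      calc _ = (φ (r i) - φ (r (i + (t + 1) • 1))) ^ 2 := by simp only [ψ]; ring
        _ ≤ _ := this
        _ = _ := by ring
    calc S = ∑ t : Fin (m + 2), ∑ i,
          (ψ (i + ((t : ℕ) + 1) • 1) - ψ i) ^ 2 / (((t : ℕ) : ℝ) + 1) ^ 2 := by
          simp only [S, Finset.sum_div]
          rw [Finset.sum_range]
      _ ≤ ∑ t : Fin (m + 2), ∑ i, 4 * M ^ 2 * τ (r i, r (i + ((t : ℕ) + 1) • 1)) :=
          Finset.sum_le_sum fun t _ => Finset.sum_le_sum fun i _ => h1 t i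
      _ = 4 * M ^ 2 * ∑ y : Fin (m + 2) × Fin (n + 2),
          τ (r y.2, r (y.2 + ((y.1 : ℕ) + 1) • 1)) := by
          simp only [← Finset.mul_sum]
          rw [Fintype.sum_prod_type]
      _ ≤ 4 * M ^ 2 * Q := by
          refine mul_le_mul_of_nonneg_left ?_ (by positivity)
          rw [← hτsum]
          refine sum_comp_le_of_injective
            (x := fun y : Fin (m + 2) × Fin (n + 2) => (r y.2, r (y.2 + ((y.1 : ℕ) + 1) • 1)))
            ?_ τ hτ0
          -- The shifts `t + 1 ≤ m + 2` stay below the cycle length since `m < n`, so no ordered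
          -- pair of representatives is counted twice.
          rintro ⟨t, i⟩ ⟨t', i'⟩ h
          simp only [Prod.mk.injEq] at h
          obtain rfl := hrinj h.1
          have h2 := congrArg Fin.val (add_left_cancel (hrinj h.2))
          have := t.2
          have := t'.2
          rw [val_nsmul_one, val_nsmul_one, Nat.mod_eq_of_lt (by omega),
            Nat.mod_eq_of_lt (by omega)] at h2
          exact Prod.ext (Fin.ext (by simpa using h2)) rfl
  have hvar : ∑ i, (ψ i - x) ^ 2 ≤ M ^ 2 * k * Q := by
    have h1 : ∀ i, (ψ i - x) ^ 2 ≤ (∑ j, (ψ i - ψ j) ^ 2) / k := by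
      intro i
      have hcard : (Fintype.card (Fin (n + 2)) : ℝ) = k := by simp [k]
      have h2 : ψ i - x = (∑ j, (ψ i - ψ j)) / k := by
        rw [Finset.sum_sub_distrib, Finset.sum_const, nsmul_eq_mul, Finset.card_univ, hcard]
        simp only [x]; field_simp
      have h3 := sq_sum_le_card_mul_sum_sq (s := Finset.univ) (f := fun j => ψ i - ψ j)
      rw [Finset.card_univ, hcard] at h3
      rw [h2, div_pow, div_le_div_iff₀ (by positivity) hk]
      nlinarith
    have h4 : ∀ i j, (ψ i - ψ j) ^ 2 ≤ M ^ 2 * k ^ 2 * τ (r i, r j) := by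
      intro i j
      have hd := hdist (r i) (r j) (j - i).val (by
        rw [hr, hr, val_nsmul_one_self]; abel)
      have := (j - i).2
      have := hτ (r i) (r j) (M * (n + 2)) (hd.le.trans (Nat.mul_le_mul_left M (by omega)))
      push_cast at this
      rw [mul_pow] at this
      exact this
    calc _ ≤ ∑ i, (∑ j, (ψ i - ψ j) ^ 2) / k := Finset.sum_le_sum fun i _ => h1 i
      _ ≤ ∑ i, (∑ j, M ^ 2 * k ^ 2 * τ (r i, r j)) / k := by
          refine Finset.sum_le_sum fun i _ => ?_
          gcongr with j
          exact h4 i j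
      _ = M ^ 2 * k * ∑ y : Fin (n + 2) × Fin (n + 2), τ (r y.1, r y.2) := by
          rw [← Finset.sum_div]
          simp only [← Finset.mul_sum]
          rw [Fintype.sum_prod_type]
          field_simp
      _ ≤ _ := by
          refine mul_le_mul_of_nonneg_left ?_ (by positivity)
          rw [← hτsum]
          refine sum_comp_le_of_injective
            (x := fun y : Fin (n + 2) × Fin (n + 2) => (r y.1, r y.2)) ?_ τ hτ0
          rintro ⟨t, i⟩ ⟨t', i'⟩ h
          simp only [Prod.mk.injEq] at h
          exact Prod.ext (hrinj h.1) (hrinj h.2)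
  have hdev : ∑ p, (φ p - ψ (C p)) ^ 2 ≤ M ^ 2 * Q := by
    calc _ ≤ ∑ p : {v // v ∈ Γ}, M ^ 2 * τ (p, r (C p)) := by
          refine Finset.sum_le_sum fun p _ => hτ p (r (C p)) M ?_
          have := hdist p (r (C p)) 0 (by rw [hr]; simp)
          simpa using this.le
      _ ≤ _ := by
          rw [← Finset.mul_sum, ← hτsum]
          refine mul_le_mul_of_nonneg_left ?_ (by positivity)
          exact sum_comp_le_of_injective (x := fun p : {v // v ∈ Γ} => (p, r (C p)))
            (fun p q h => congrArg Prod.fst h) τ hτ0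
  let W := cylinderExtension ψ 1 x (m + 1)
  have hW0 : ∀ i, W i 0 = ψ i := cylinderExtension_zero ψ 1 x (m + 1)
  have hWlast : ∀ i, W i (m + 1) = x := cylinderExtension_last ψ 1 x (Nat.succ_ne_zero m)
  have hh := cylinderExtension_horizontal ψ 1 x (m + 1)
  have hv := cylinderExtension_vertical ψ 1 x (Nat.succ_ne_zero m)
  let f := pullback a W x
  -- The pullback takes the representative's value on all of a column's boundary vertices; `g` is
  -- the remaining error.
  let g : V → ℝ := fun v => if h : v ∈ Γ then φ ⟨v, h⟩ - ψ (C v) else 0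
  have hgrid : dirichlet G f ≤ M ^ 2 * (10 * ((8 + 8 * c) * M ^ 2 * Q)) := by
    refine (hP.dirichlet_pullback_le hstar W x hWlast).trans ?_
    refine mul_le_mul_of_nonneg_left ((gridStar_form_le W).trans ?_) (by positivity)
    refine mul_le_mul_of_nonneg_left ?_ (by norm_num)
    have h1 : 2 / ((m + 1 : ℕ) : ℝ) * ∑ i, (ψ i - x) ^ 2 ≤ 8 * c * M ^ 2 * Q := by
      -- From `k < 2 * c * (m + 2)` and `m + 2 ≤ 2 * (m + 1)`: the cylinder is long enough for its
      -- cutoff slope to offset the variance, which grows like `k`.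
      have hkc : k ≤ 4 * c * ((m : ℝ) + 1) := by
        have h2 : n + 2 ≤ 4 * c * (m + 1) := by nlinarith
        simp only [k]
        exact_mod_cast h2
      push_cast
      rw [div_mul_eq_mul_div, div_le_iff₀ (by positivity)]
      have := mul_le_mul_of_nonneg_right hkc (show 0 ≤ M ^ 2 * Q by positivity)
      nlinarith
    change _ ≤ S at hh
    change _ ≤ S + _ at hv
    calc _ ≤ S + (S + 2 / ((m + 1 : ℕ) : ℝ) * ∑ i, (ψ i - x) ^ 2) := add_le_add hh hv
      _ ≤ _ := by nlinarith
  have hg : dirichlet G g ≤ 24 * M ^ 3 * Q := by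
    have h1 : ∀ v, (G.degree v : ℝ) * g v ^ 2 ≤ 6 * M * g v ^ 2 := by
      intro v
      by_cases hv : v ∈ Γ
      · refine mul_le_mul_of_nonneg_right ?_ (sq_nonneg _)
        exact_mod_cast hP.degree_le hstar (hC v hv)
      · simp [g, hv]
    have h2 : ∑ v, g v ^ 2 = ∑ p, (φ p - ψ (C p)) ^ 2 := by
      rw [← Finset.sum_subset (Finset.subset_univ Γ) (fun v _ hv => by simp [g, hv]),
        ← Finset.sum_coe_sort Γ]
      refine Finset.sum_congr rfl fun p _ => ?_
      simp [g]
    refine (dirichlet_le_degree g).trans ?_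
    have h3 := Finset.sum_le_sum fun v (_ : v ∈ Finset.univ) => h1 v
    rw [← Finset.mul_sum, h2] at h3
    have h4 := mul_le_mul_of_nonneg_left hdev (show (0 : ℝ) ≤ 6 * M by positivity)
    nlinarith
  refine ⟨fun v => f v + g v, fun p => ?_, ?_⟩
  · have h1 : f p = ψ (C p) := by
      simp only [f]
      rw [hP.pullback_of_mem W x (hC p p.2)]
      exact hW0 _
    simp [h1, g]
  -- The constant is `2 * (80 + 80 * c) + 2 * 24 = 160 * c + 208`.
  · refine (dirichlet_add_le f g).trans ?_
    have h1 : (M : ℝ) ^ 3 * Q ≤ M ^ 4 * Q :=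
      mul_le_mul_of_nonneg_right (pow_le_pow_right₀ hM1 (by norm_num)) hQ0
    nlinarith

end IsAggregationPartition

/-! ### Existence of a minimizer -/

section Minimum

variable {V : Type*} [Fintype V] {G : SimpleGraph V} [DecidableRel G.Adj]

lemma dirichlet_le_of_abs_sub_le {u u' : V → ℝ} (h : ∀ v w, |u v - u w| ≤ |u' v - u' w|) :
    dirichlet G u ≤ dirichlet G u' := by
  refine Finset.sum_le_sum fun v _ => Finset.sum_le_sum fun w _ => ?_
  split_ifs
  · exact sq_le_sq.2 (h v w)
  · exact le_rfl

lemma continuous_dirichlet : Continuous fun u : V → ℝ => dirichlet G u := by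
  refine continuous_finsetSum _ fun v _ => continuous_finsetSum _ fun w _ => ?_
  split_ifs
  · fun_prop
  · fun_prop

/-- Among all extensions of a boundary function there is one of least energy. -/
theorem exists_dirichlet_minimizer (Γ : Finset V) (φ : {v // v ∈ Γ} → ℝ) :
    ∃ u : V → ℝ, (∀ p : {v // v ∈ Γ}, u p = φ p) ∧
      ∀ u' : V → ℝ, (∀ p : {v // v ∈ Γ}, u' p = φ p) → dirichlet G u ≤ dirichlet G u' := by
  classical
  let B := ∑ p, |φ p|
  have hB : 0 ≤ B := Finset.sum_nonneg fun p _ => abs_nonneg _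
  have hφ : ∀ p, φ p ∈ Set.Icc (-B) B := fun p =>
    abs_le.1 (Finset.single_le_sum (f := fun p => |φ p|) (fun p _ => abs_nonneg _)
      (Finset.mem_univ p))
  have hBB : -B ≤ B := by linarith
  let K : Set (V → ℝ) := (Set.univ.pi fun _ => Set.Icc (-B) B) ∩
    {u | ∀ p : {v // v ∈ Γ}, u p = φ p}
  have hK : IsCompact K := by
    refine (isCompact_univ_pi fun _ => isCompact_Icc).inter_right ?_
    simp only [Set.ofPred_forall]
    exact isClosed_iInter fun p => isClosed_eq (continuous_apply _) continuous_const
  -- Truncation to an interval containing the boundary values keeps them and, being 1-Lipschitz,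
  -- does not raise the energy; so minimizing over the compact set `K` suffices.
  have hclamp : ∀ u : V → ℝ, (∀ p : {v // v ∈ Γ}, u p = φ p) →
      (fun v => (Set.projIcc (-B) B hBB (u v) : ℝ)) ∈ K := by
    intro u hu
    refine ⟨fun v _ => Subtype.coe_prop _, fun p => ?_⟩
    simp only [hu p]
    rw [Set.projIcc_of_mem hBB (hφ p)]
  have hne : K.Nonempty :=
    ⟨_, hclamp (fun v => if h : v ∈ Γ then φ ⟨v, h⟩ else 0) fun p => by simp⟩
  obtain ⟨u, huK, hu⟩ := hK.exists_isMinOn hne (continuous_dirichlet (G := G)).continuousOn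
  refine ⟨u, huK.2, fun u' hu' => (hu (hclamp u' hu')).trans ?_⟩
  refine dirichlet_le_of_abs_sub_le fun v w => ?_
  have := (LipschitzWith.projIcc hBB).dist_le_mul (u' v) (u' w)
  rwa [NNReal.coe_one, one_mul, Subtype.dist_eq, Real.dist_eq, Real.dist_eq] at this

end Minimum

lemma IsThreeConnected.preconnected {V : Type*} {G : SimpleGraph V} (h : IsThreeConnected G) :
    G.Preconnected := by
  have h1 := (h ∅ (by simp)).preconnected
  have h2 : {v : V | v ∉ (∅ : Finset V)} = Set.univ := by ext; simp
  rw [h2] at h1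
  exact (SimpleGraph.induceUnivIso G).preconnected_iff.1 h1

end TraceGraph

/-! ### The two-sided trace estimate -/

theorem corollary3p4 {V : Type*} [Fintype V] [DecidableEq V]
    (G : SimpleGraph V) [DecidableRel G.Adj] (Γ : Finset V)
    (hG : TraceGraph.IsPlanarWithBoundary G Γ)
    (k l c M : ℕ) (hl : 2 ≤ l) (hkl : 4 * l < k) (hkc : k < 2 * c * l)
    (H : SimpleGraph (Fin k × Fin l)) (hH : TraceGraph.IsMAggregation G Γ M H)
    (φ : {v // v ∈ Γ} → ℝ) :
    ∃ m : ℝ,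
      IsLeast {r : ℝ | ∃ u : V → ℝ, (∀ p : {v // v ∈ Γ}, u p = φ p) ∧
        r = TraceGraph.energy G u} m ∧
      1 / (6 * (M : ℝ) * √((M : ℝ) + 3) * max (√(3 * (c : ℝ))) (2 * Real.pi)) *
        √((TraceGraph.boundaryLaplacian G Γ *ᵥ φ) ⬝ᵥ φ) ≤ m ∧
      m ≤ 28 * (M : ℝ) ^ 2 * √(3 * (c : ℝ) + 20) *
        √((TraceGraph.boundaryLaplacian G Γ *ᵥ φ) ⬝ᵥ φ) := by
  obtain ⟨-, hconn, R, hR, hΓ⟩ := hG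
  obtain ⟨hgrid, hstar, a, aStar, hP⟩ := hH
  obtain ⟨m, rfl⟩ : ∃ m, l = m + 2 := ⟨l - 2, by omega⟩
  obtain ⟨n, rfl⟩ : ∃ n, k = n + 2 := ⟨k - 2, by omega⟩
  obtain ⟨hpre, C, hC, hdist⟩ :=
    hP.exists_column hgrid hstar (by omega) hR hconn.preconnected hΓ
  obtain ⟨u, hu, hmin⟩ := TraceGraph.exists_dirichlet_minimizer (G := G) Γ φ
  obtain ⟨u', hu', hle⟩ := hP.exists_extension hstar hC hpre hdist (by omega) hkc φ
  have hM : (1 : ℝ) ≤ M := by exact_mod_cast hP.one_le_bound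
  have hQ := TraceGraph.boundaryForm_nonneg G Γ φ
  rw [TraceGraph.boundaryLaplacian_form]
  refine ⟨TraceGraph.energy G u, ⟨⟨u, hu, rfl⟩, ?_⟩, ?_, ?_⟩
  · rintro r ⟨w, hw, rfl⟩
    rw [TraceGraph.energy_eq, TraceGraph.energy_eq]
    exact Real.sqrt_le_sqrt (by linarith [hmin w hw])
  · set X := max (√(3 * (c : ℝ))) (2 * Real.pi) with hX
    -- Since `2 * π > 6`, the square of `X` is at least 36, the threshold required by
    -- `boundaryForm_le_dirichlet`.
    have hXpi : 6 ≤ X := le_max_of_le_right (by linarith [Real.pi_gt_three])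
    have hXc : 3 * (c : ℝ) ≤ X ^ 2 := by
      rw [← Real.sq_sqrt (show (0 : ℝ) ≤ 3 * c by positivity)]
      exact pow_le_pow_left₀ (Real.sqrt_nonneg _) (le_max_left _ _) 2
    have h1 := hP.boundaryForm_le_dirichlet hgrid hstar hC hpre hkc hXc (by nlinarith) u
    simp only [hu] at h1
    have hE := TraceGraph.dirichlet_nonneg G u
    rw [TraceGraph.energy_eq, one_div, inv_mul_le_iff₀ (by positivity)]
    refine Real.sqrt_le_iff.2 ⟨by positivity, ?_⟩
    rw [mul_pow, mul_pow, mul_pow, mul_pow, Real.sq_sqrt (by positivity),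
      Real.sq_sqrt (by positivity)]
    have h2 : (0 : ℝ) ≤ M ^ 2 * X ^ 2 * TraceGraph.dirichlet G u := by positivity
    nlinarith
  -- After squaring, the claim reduces to `160 * c + 208 ≤ 28 ^ 2 * (3 * c + 20)`.
  · rw [TraceGraph.energy_eq]
    refine Real.sqrt_le_iff.2 ⟨by positivity, ?_⟩
    rw [mul_pow, mul_pow, mul_pow, Real.sq_sqrt (by positivity), Real.sq_sqrt (by positivity)]
    have h1 := (hmin u' hu').trans hle
    have h2 : 0 ≤ (M : ℝ) ^ 4 * TraceGraph.boundaryForm G Γ φ := by positivity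
    have h3 : 0 ≤ (c : ℝ) * ((M : ℝ) ^ 4 * TraceGraph.boundaryForm G Γ φ) := by positivity
    nlinarith
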